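/- Let $m\ge 1$ and let $H^m$ be the Heisenberg group, i.e. $\mathbb R^{2m+1}$ with points $q=(x,y,t)$, $x,y\in\mathbb R^m$, $t\in\mathbb R$, and with the left-invariant vector fields $$X_j=\partial_{x_j}+2y_j\,\partial_t,\qquad Y_j=\partial_{y_j}-2x_j\,\partial_t\qquad(1\le j\le m).$$ For $u\in C^1(H^m)$ let $\nabla_{H^m}u=(X_1u,\dots,X_mu,Y_1u,\dots,Y_mu)$, with the Euclidean inner product and norm on these components. Let $p>1$ and $\varphi(t)=t^{p-1}$ for $t\ge 0$. Let $f,g:[0,\infty)\to\mathbb R$ and $h:(0,\infty)\to\mathbb R$ be such that * (F) $f$ is continuous and non-decreasing on $[0,\infty)$ and $f>0$ on $(0,\infty)$; * (H) $h$ is continuous, non-negative and non-increasing on $(0,\infty)$, and integrable near $0$; moreover $h\in L^1(0,\infty)$; * (G) with $\tau=0$: $g$ is continuous and non-negative, and for some $\widetilde D>0$, $\;g(st)\le \widetilde D\, s\, t^2\varphi'(t)$ for all $s\in[0,1]$, $t>0$. Assume also the following two conditions, both of which in fact hold automatically for $\varphi(t)=t^{p-1}$: * ($\Phi2$) with $\tau=0$: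 for some $D>0$, $\;s\varphi'(st)\le D\varphi'(t)$ for all $s\in[0,1]$, $t>0$ (the left-hand side being $0$ for $s=0$); * ($\Phi3$) for some $B>0$ and $\theta<2$, $\;\varphi'(ts)\ge B\varphi'(t)s^{-\theta}$ for all $t>0$, $s\ge1$. Put $K(t)=\int_0^t s\varphi'(s)\,ds$, let $K^{-1}:[0,\infty)\to[0,\infty)$ be its inverse on $[0,\infty)$, and let $F(t)=\int_0^t f(s)\,ds$. A non-negative solution $u\in C^1(H^m)$ of $\Delta^p_{H^m}u\ge f(u)-h(u)g(|\nabla_{H^m}u|)$ is understood weakly: $f(u)-h(u)g(|\nabla_{H^m}u|)\in L^1_{\mathrm{loc}}$, and for every $\zeta\in C_0^\infty(H^m)$ with $\zeta\ge0$, $$-\int_{\mathbb R^{2m+1}}|\nabla_{H^m}u|^{p-2}\,\nabla_{H^m}u\cdot\nabla_{H^m}\zeta\;\ge\;\int_{\mathbb R^{2m+1}}\bigl(f(u)-h(u)g(|\nabla_{H^m}u|)\bigr)\zeta ,$$ where $|\nabla_{H^m}u|^{p-2}\nabla_{H^m}u$ is read as $0$ where $\nabla_{H^m}u=0$, and $h(u)g(|\nabla_{H^m}u|)$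 is read as $0$ where $u=0$ (at such points $\nabla_{H^m}u=0$, and $g(0)=0$ by (G)). Then the following are equivalent: 1. there exists a non-negative, non-constant solution $u\in C^1(H^m)$ of $\Delta^p_{H^m}u\ge f(u)-h(u)g(|\nabla_{H^m}u|)$ on $H^m$; 2. $\dfrac{1}{K^{-1}(F(t))}\notin L^1(+\infty)$, i.e. this function is not integrable on any neighbourhood of $+\infty$. -/

import Mathlib

open MeasureTheory Set Filter Topology
open scoped ContDiff

namespace HeisenbergKO

/-- The manifold underlying the Heisenberg group `H^m`, that is `ℝ^(2m+1)` with points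
`q = (x, y, t)`, `x, y ∈ ℝ^m`, `t ∈ ℝ`.  Its `volume` is Lebesgue measure. -/
abbrev Heis (m : ℕ) : Type := (Fin m → ℝ) × (Fin m → ℝ) × ℝ

/-- The left-invariant field `X_j = ∂/∂x_j + 2 y_j ∂/∂t` applied to `u` at `q`. -/
noncomputable def fieldX {m : ℕ} (j : Fin m) (u : Heis m → ℝ) (q : Heis m) : ℝ :=
  fderiv ℝ u q (Pi.single j 1, 0, 2 * q.2.1 j)

/-- The left-invariant field `Y_j = ∂/∂y_j - 2 x_j ∂/∂t` applied to `u` at `q`. -/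
noncomputable def fieldY {m : ℕ} (j : Fin m) (u : Heis m → ℝ) (q : Heis m) : ℝ :=
  fderiv ℝ u q (0, Pi.single j 1, -(2 * q.1 j))

/-- The Heisenberg gradient, given by its coefficients in the frame
`X_1, …, X_m, Y_1, …, Y_m`; the `·` product of the frame is the Euclidean inner product. -/
noncomputable def gradH {m : ℕ} (u : Heis m → ℝ) (q : Heis m) :
    EuclideanSpace ℝ (Fin m ⊕ Fin m) :=
  WithLp.toLp 2 (Sum.elim (fun j => fieldX j u q) (fun j => fieldY j u q))

/-- `u` is an entire weak classical solution on `H^m` of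
`Δ^φ u ≥ f(u) - h(u) g(|∇_H u|)`: `u` is `C^1`, the right-hand side is locally integrable, and
`-∫ |∇_H u|⁻¹ φ(|∇_H u|) ∇_H u · ∇_H ζ ≥ ∫ (f(u) - h(u) g(|∇_H u|)) ζ`
for all non-negative `ζ ∈ C_0^∞(H^m)`. -/
structure IsWeakSolution {m : ℕ} (φ f h g : ℝ → ℝ) (u : Heis m → ℝ) : Prop where
  contDiff : ContDiff ℝ 1 u
  locallyIntegrable :
    LocallyIntegrable (fun q => f (u q) - h (u q) * g ‖gradH u q‖) volume
  weak_ineq : ∀ ζ : Heis m → ℝ, ContDiff ℝ ∞ ζ → HasCompactSupport ζ → (∀ q, 0 ≤ ζ q) →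
    ∫ q, (f (u q) - h (u q) * g ‖gradH u q‖) * ζ q ≤
      -∫ q, ‖gradH u q‖⁻¹ * φ ‖gradH u q‖ * inner ℝ (gradH u q) (gradH ζ q)

/-- The function `φ(t) = t^(p-1)`, `t ≥ 0`, for which `Δ^φ` is the `p`-Laplacian. -/
noncomputable def phiP (p : ℝ) (t : ℝ) : ℝ := t ^ (p - 1)

/-- Condition (F): `f` is continuous and increasing (in the wide sense) on `[0, ∞)` and
positive on `(0, ∞)`. -/
structure CondF (f : ℝ → ℝ) : Prop where
  continuousOn : ContinuousOn f (Ici 0)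
  pos : ∀ t, 0 < t → 0 < f t
  monotoneOn : MonotoneOn f (Ici 0)

/-- Condition (H): `h` is continuous, non-negative and non-increasing on `(0, ∞)`, and
integrable near `0`. -/
structure CondH (h : ℝ → ℝ) : Prop where
  continuousOn : ContinuousOn h (Ioi 0)
  nonneg : ∀ t, 0 < t → 0 ≤ h t
  antitoneOn : AntitoneOn h (Ioi 0)
  integrableAtZero : IntegrableAtFilter h (𝓝[>] 0) volume

/-- Condition (Φ2): `s φ'(st) ≤ D s^τ φ'(t)`. -/
def CondPhi2 (φ : ℝ → ℝ) (τ : ℝ) : Prop :=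
  ∃ D : ℝ, 0 < D ∧ ∀ s ∈ Icc (0 : ℝ) 1, ∀ t : ℝ, 0 < t →
    s * deriv φ (s * t) ≤ D * s ^ τ * deriv φ t

/-- Condition (Φ3): `φ'(ts) ≥ B φ'(t) s^(-θ)`. -/
def CondPhi3 (φ : ℝ → ℝ) : Prop :=
  ∃ B θ : ℝ, 0 < B ∧ θ < 2 ∧ ∀ t : ℝ, 0 < t → ∀ s : ℝ, 1 ≤ s →
    B * deriv φ t * s ^ (-θ) ≤ deriv φ (t * s)

/-- Condition (G): `g(st) ≤ D s^(τ+1) t² φ'(t)`. -/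
def CondG (φ : ℝ → ℝ) (τ : ℝ) (g : ℝ → ℝ) : Prop :=
  ∃ D : ℝ, 0 < D ∧ ∀ s ∈ Icc (0 : ℝ) 1, ∀ t : ℝ, 0 < t →
    g (s * t) ≤ D * s ^ (τ + 1) * t ^ 2 * deriv φ t

/-- `K(t) = ∫_0^t s φ'(s) ds`. -/
noncomputable def K (φ : ℝ → ℝ) (t : ℝ) : ℝ := ∫ s in (0 : ℝ)..t, s * deriv φ s

/-- The inverse of `K : [0, ∞) → [0, ∞)`. -/
noncomputable def Kinv (φ : ℝ → ℝ) : ℝ → ℝ := Function.invFunOn (K φ) (Ici 0)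

/-- `F(t) = ∫_0^t f(s) ds`. -/
noncomputable def primF (f : ℝ → ℝ) (t : ℝ) : ℝ := ∫ s in (0 : ℝ)..t, f s

/-- The Keller-Osserman condition `1 / K⁻¹(F(t)) ∈ L^1(+∞)`. -/
def KellerOsserman (φ f : ℝ → ℝ) : Prop :=
  IntegrableAtFilter (fun t => 1 / Kinv φ (primF f t)) atTop volume

end HeisenbergKO

open HeisenbergKO

/-! Solutions exist when the Keller-Osserman integral diverges because of a one-dimensional ODE, and
fail to exist when it converges because of comparison with powers of the gauge.

Convergence forces `u = 0`. Condition (G) gives `g r ≤ C r^p`, so the gradient term is at most `C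
h(u) |∇u|^p`. Put `H(s) = ∫_0^s h` and `Ψ' = j = exp (C H / (p - 1))`. Since `(j^(p-1))' = C h
j^(p-1)`, the function `v = Ψ(u)` satisfies weakly `Δ_p v ≥ j(u)^(p-1) f(u) ≥ f(u)`, with no
gradient term. Integrability of `h` makes `j` bounded, so `u ≤ v ≤ M u` and `f(u) ≥ f(v / M)`
(`exists_isGradTransform`, `integral_transform_le`).

The barriers are `w = b + c N^lam` with `N = |z|^4 + t^2`. Their `p`-Laplacian is bounded on `{N <
L}` (`neg_integral_pField_rpow_le`). If that bound is below `f(b / M)` and `v < w` on `{N = L}`,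
monotonicity of the flux gives `v ≤ w` inside (`comparison`). Letting `L → ∞` shows that a bounded
solution vanishes (`eq_zero_of_bounded`). Otherwise, if `v` reaches a large value `a` on `{N ≤ L}`,
it reaches `2a` on `{N ≤ L e^r}` (`exists_doubling`). For `a` comparable to `2^k`, a step `r`
proportional to `((2^k)^(p-1) / f(2^k))^(1/p)` suffices. By Cauchy condensation these steps are
summable (`KellerOsserman.summable`), so `v` would be unbounded on a compact set.

Divergence gives a solution. The first integral of `(|w'|^(p-2) w')' = f(w)`, `w(0) = 1`, `w'(0) =
0`, is `(p-1)/p |w'|^p = F(w) - F(1)`. The time needed to reach infinite height is a Keller-Osserman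
integral, so `w` is global (`exists_profile`). Then `u(q) = w(x_j)` solves `Δ_p u = f(u)`, and the
term `-h g ≤ 0` only helps (`isWeakSolution_profile`). -/

namespace HeisenbergKO

/-! ### The flux `|a|^(p-2) a`: continuity, homogeneity, monotonicity -/

section PField

variable {V : Type*} [NormedAddCommGroup V] [InnerProductSpace ℝ V]

/-- The `p`-Laplacian flux `a ↦ |a|^(p-2) a`. -/
noncomputable def pField (p : ℝ) (a : V) : V := (‖a‖⁻¹ * phiP p ‖a‖) • a

lemma norm_pField {p : ℝ} (hp : 1 < p) (a : V) : ‖pField p a‖ = ‖a‖ ^ (p - 1) := by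
  rcases eq_or_ne a 0 with rfl | ha
  · simp [pField, Real.zero_rpow (sub_ne_zero.2 hp.ne')]
  · have h := norm_pos_iff.2 ha
    rw [pField, phiP, norm_smul, Real.norm_of_nonneg (by positivity)]
    field_simp

lemma pField_eq_smul {p : ℝ} {a : V} (ha : a ≠ 0) : pField p a = ‖a‖ ^ (p - 2) • a := by
  have h := norm_pos_iff.2 ha
  rw [pField, phiP, show p - 2 = (p - 1) - 1 by ring, Real.rpow_sub_one h.ne' (p - 1),
    div_eq_inv_mul]

lemma continuous_pField {p : ℝ} (hp : 1 < p) : Continuous (pField p : V → V) := by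
  refine continuous_iff_continuousAt.2 fun a => ?_
  rcases eq_or_ne a 0 with rfl | ha
  · have h0 : pField p (0 : V) = 0 := by simp [pField]
    rw [ContinuousAt, h0, tendsto_zero_iff_norm_tendsto_zero]
    simp_rw [norm_pField hp]
    have : Tendsto (fun a : V => ‖a‖ ^ (p - 1)) (𝓝 0) (𝓝 (‖(0 : V)‖ ^ (p - 1))) :=
      (continuous_norm.rpow_const fun _ => Or.inr (by linarith)).tendsto _
    simpa [Real.zero_rpow (sub_ne_zero.2 hp.ne')] using this
  · have h : ‖a‖ ≠ 0 := norm_ne_zero_iff.2 ha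
    exact ((continuousAt_id.norm.inv₀ h).mul
      (continuousAt_id.norm.rpow_const (Or.inl h))).smul continuousAt_id

lemma inner_pField_self {p : ℝ} (hp : 1 < p) (a : V) : inner ℝ (pField p a) a = ‖a‖ ^ p := by
  rcases eq_or_ne a 0 with rfl | ha
  · simp [Real.zero_rpow (by linarith : p ≠ 0)]
  · have h := norm_pos_iff.2 ha
    rw [pField_eq_smul ha, real_inner_smul_left, real_inner_self_eq_norm_sq, ← Real.rpow_natCast,
      ← Real.rpow_add h]
    norm_num

/-- Cauchy-Schwarz on the two cross terms reduces this to `(|a|^(p-1) - |b|^(p-1)) (|a| - |b|) ≥ 0`,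
where the factors have the same sign. -/
lemma inner_pField_sub_nonneg {p : ℝ} (hp : 1 < p) (a b : V) :
    0 ≤ inner ℝ (pField p a - pField p b) (a - b) := by
  have key : ∀ c d : V, inner ℝ (pField p c) d ≤ ‖c‖ ^ (p - 1) * ‖d‖ := fun c d => by
    rw [← norm_pField hp]; exact real_inner_le_norm _ _
  have hpow : ∀ c : V, ‖c‖ ^ p = ‖c‖ ^ (p - 1) * ‖c‖ := fun c => by
    rcases eq_or_ne c 0 with rfl | hc
    · simp [Real.zero_rpow (by linarith : p ≠ 0)]
    · rw [← Real.rpow_add_one (norm_ne_zero_iff.2 hc)]; ring_nf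
  have hmono : 0 ≤ (‖a‖ ^ (p - 1) - ‖b‖ ^ (p - 1)) * (‖a‖ - ‖b‖) := by
    rcases le_total ‖a‖ ‖b‖ with h | h
    · exact mul_nonneg_of_nonpos_of_nonpos
        (sub_nonpos.2 (Real.rpow_le_rpow (norm_nonneg _) h (by linarith))) (sub_nonpos.2 h)
    · exact mul_nonneg (sub_nonneg.2 (Real.rpow_le_rpow (norm_nonneg _) h (by linarith)))
        (sub_nonneg.2 h)
  rw [inner_sub_left, inner_sub_right, inner_sub_right, inner_pField_self hp, inner_pField_self hp]
  have h1 := key a b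
  have h2 := key b a
  rw [hpow a, hpow b]
  nlinarith

lemma pField_smul {p : ℝ} {s : ℝ} (hs : 0 < s) (a : V) :
    pField p (s • a) = s ^ (p - 1) • pField p a := by
  rw [pField, pField, phiP, phiP, norm_smul, Real.norm_of_nonneg hs.le,
    Real.mul_rpow hs.le (norm_nonneg _), smul_smul, smul_smul]
  congr 1
  field_simp

end PField

instance instIsAddHaarMeasureVolumeHeis (m : ℕ) :
    (volume : Measure (Heis m)).IsAddHaarMeasure :=
  Measure.prod.instIsAddHaarMeasure _ (Measure.prod volume volume)

/-! ### The horizontal gradient as a linear map of the differential -/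

section Horizontal

variable {m : ℕ}

/-- The horizontal part, in the frame `X_1, …, X_m, Y_1, …, Y_m`, of a covector at `q`. -/
noncomputable def horiz (q : Heis m) (l : Heis m →L[ℝ] ℝ) : EuclideanSpace ℝ (Fin m ⊕ Fin m) :=
  WithLp.toLp 2 (Sum.elim (fun j => l (Pi.single j 1, 0, 2 * q.2.1 j))
    (fun j => l (0, Pi.single j 1, -(2 * q.1 j))))

lemma gradH_eq_horiz (u : Heis m → ℝ) (q : Heis m) : gradH u q = horiz q (fderiv ℝ u q) := rfl

lemma horiz_add (q : Heis m) (l l' : Heis m →L[ℝ] ℝ) :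
    horiz q (l + l') = horiz q l + horiz q l' := by
  ext i; rcases i with j | j <;> simp [horiz]

lemma horiz_sub (q : Heis m) (l l' : Heis m →L[ℝ] ℝ) :
    horiz q (l - l') = horiz q l - horiz q l' := by
  ext i; rcases i with j | j <;> simp [horiz]

lemma horiz_smul (q : Heis m) (c : ℝ) (l : Heis m →L[ℝ] ℝ) :
    horiz q (c • l) = c • horiz q l := by
  ext i; rcases i with j | j <;> simp [horiz]

@[simp] lemma horiz_zero (q : Heis m) : horiz q (0 : Heis m →L[ℝ] ℝ) = 0 := by
  ext i; rcases i with j | j <;> simp [horiz]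

lemma continuous_uncurry_horiz :
    Continuous fun x : Heis m × (Heis m →L[ℝ] ℝ) => horiz x.1 x.2 := by
  refine (PiLp.continuous_toLp 2 _).comp (continuous_pi fun i => ?_)
  rcases i with j | j <;> simp only [Sum.elim_inl, Sum.elim_inr]
  · exact continuous_snd.clm_apply (by fun_prop)
  · exact continuous_snd.clm_apply (by fun_prop)

lemma continuous_gradH {u : Heis m → ℝ} (hu : ContDiff ℝ 1 u) : Continuous (gradH u) :=
  continuous_uncurry_horiz.comp (continuous_id.prodMk (hu.continuous_fderiv one_ne_zero))

lemma hasCompactSupport_gradH {u : Heis m → ℝ} (hu : HasCompactSupport u) :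
    HasCompactSupport (gradH u) := by
  refine (hu.fderiv (𝕜 := ℝ)).mono ?_
  intro q hq
  contrapose! hq
  simp only [Function.mem_support, not_not] at hq ⊢
  rw [gradH_eq_horiz, hq, horiz_zero]

end Horizontal

/-! ### Mollification: from smooth to `C^1` test functions -/

section Mollify

variable {E : Type*} [NormedAddCommGroup E] [NormedSpace ℝ E] [FiniteDimensional ℝ E]
  [MeasurableSpace E] [BorelSpace E]

open scoped Convolution

/-- Values of `g` differ by at most `2C`, hence so do the average and `g q`; the crude factor 3 is
enough for dominated convergence. -/
lemma norm_normed_convolution_le {F : Type*} [NormedAddCommGroup F] [NormedSpace ℝ F]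
    [CompleteSpace F] (μ : Measure E) [μ.IsAddHaarMeasure] (φ : ContDiffBump (0 : E)) {g : E → F}
    (hg : Continuous g) {C : ℝ} (hC : ∀ x, ‖g x‖ ≤ C) (q : E) :
    ‖(φ.normed μ ⋆[ContinuousLinearMap.lsmul ℝ ℝ, μ] g) q‖ ≤ 3 * C := by
  have h := φ.dist_normed_convolution_le (μ := μ) (x₀ := q) (ε := C + C)
    hg.aestronglyMeasurable fun x _ => (dist_le_norm_add_norm _ _).trans (add_le_add (hC x) (hC q))
  rw [dist_eq_norm] at h
  have := norm_le_norm_add_norm_sub' ((φ.normed μ ⋆[ContinuousLinearMap.lsmul ℝ ℝ, μ] g) q) (g q)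
  linarith [hC q]

lemma normed_convolution_eq_zero {F : Type*} [NormedAddCommGroup F] [NormedSpace ℝ F]
    [CompleteSpace F] (μ : Measure E) [μ.IsAddHaarMeasure] (φ : ContDiffBump (0 : E)) {g : E → F}
    {s : Set E} (hs : ∀ x ∉ s, g x = 0) {q : E} {r : ℝ} (hr : φ.rOut ≤ r)
    (hq : q ∉ Metric.cthickening r s) :
    (φ.normed μ ⋆[ContinuousLinearMap.lsmul ℝ ℝ, μ] g) q = 0 := by
  have key : ∀ x ∈ Metric.ball q φ.rOut, g x = 0 := fun x hx => hs x fun hxs =>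
    hq (Metric.mem_cthickening_of_dist_le q x r s hxs
      ((dist_comm q x ▸ (Metric.mem_ball.1 hx).le).trans hr))
  have h0 := key q (Metric.mem_ball_self φ.rOut_pos)
  rw [φ.normed_convolution_eq_right (μ := μ) fun x hx => (key x hx).trans h0.symm, h0]

/-- Mollification of a compactly supported `C^1` function. -/
lemma exists_smooth_approx (μ : Measure E) [μ.IsAddHaarMeasure] (ζ : E → ℝ) (hζ : ContDiff ℝ 1 ζ)
    (hc : HasCompactSupport ζ) (h0 : ∀ q, 0 ≤ ζ q) :
    ∃ (Z : ℕ → E → ℝ) (S : Set E) (C : ℝ), IsCompact S ∧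
      (∀ n, ContDiff ℝ ∞ (Z n)) ∧ (∀ n q, 0 ≤ Z n q) ∧
      (∀ n q, q ∉ S → Z n q = 0 ∧ fderiv ℝ (Z n) q = 0) ∧
      (∀ n q, ‖Z n q‖ ≤ C ∧ ‖fderiv ℝ (Z n) q‖ ≤ C) ∧
      (∀ q, Tendsto (fun n => Z n q) atTop (𝓝 (ζ q))) ∧
      (∀ q, Tendsto (fun n => fderiv ℝ (Z n) q) atTop (𝓝 (fderiv ℝ ζ q))) := by
  have : ProperSpace E := FiniteDimensional.proper_rclike ℝ E
  have hd : Continuous (fderiv ℝ ζ) := hζ.continuous_fderiv one_ne_zero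
  obtain ⟨C₁, hC₁⟩ := hc.exists_bound_of_continuous hζ.continuous
  obtain ⟨C₂, hC₂⟩ := (hc.fderiv (𝕜 := ℝ)).exists_bound_of_continuous hd
  -- Outer radii `1 / (n + 1)` tend to 0 and never exceed 1, so all mollified functions live in the
  -- 1-thickening of the support.
  let φ : ℕ → ContDiffBump (0 : E) := fun n =>
    ⟨1 / (n + 1) / 2, 1 / (n + 1), by positivity, half_lt_self (by positivity)⟩
  have hφ : Tendsto (fun n => (φ n).rOut) atTop (𝓝 0) := tendsto_one_div_add_atTop_nhds_zero_nat
  have hφ1 : ∀ n, (φ n).rOut ≤ 1 := fun n =>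
    div_le_one_of_le₀ (by linarith [(n.cast_nonneg : (0 : ℝ) ≤ n)]) (by positivity)
  let Z : ℕ → E → ℝ := fun n => (φ n).normed μ ⋆[ContinuousLinearMap.lsmul ℝ ℝ, μ] ζ
  have hli : ∀ n, LocallyIntegrable ((φ n).normed μ) μ := fun n =>
    (φ n).continuous_normed.locallyIntegrable
  have hZd : ∀ n q, fderiv ℝ (Z n) q =
      ((φ n).normed μ ⋆[ContinuousLinearMap.lsmul ℝ ℝ, μ] fderiv ℝ ζ) q := fun n q => by
    rw [(hc.hasFDerivAt_convolution_right (ContinuousLinearMap.lsmul ℝ ℝ) (hli n) hζ q).fderiv]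
    simp only [convolution_def]
    congr 1
  refine ⟨Z, Metric.cthickening 1 (tsupport ζ), max (3 * C₁) (3 * C₂), hc.isCompact.cthickening,
    fun n => (φ n).hasCompactSupport_normed.contDiff_convolution_left _ (φ n).contDiff_normed
      hζ.continuous.locallyIntegrable, fun n q => ?_, fun n q hq => ⟨?_, ?_⟩,
    fun n q => ⟨?_, ?_⟩, fun q => ?_, fun q => ?_⟩
  · exact integral_nonneg fun x => mul_nonneg ((φ n).nonneg_normed x) (h0 _)
  · exact normed_convolution_eq_zero μ (φ n) (fun x hx => image_eq_zero_of_notMem_tsupport hx)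
      (hφ1 n) hq
  · rw [hZd]
    exact normed_convolution_eq_zero μ (φ n) (fun x hx => fderiv_of_notMem_tsupport ℝ hx)
      (hφ1 n) hq
  · exact (norm_normed_convolution_le μ (φ n) hζ.continuous hC₁ q).trans (le_max_left _ _)
  · rw [hZd]
    exact (norm_normed_convolution_le μ (φ n) hd hC₂ q).trans (le_max_right _ _)
  · exact ContDiffBump.convolution_tendsto_right_of_continuous hφ hζ.continuous q
  · simp_rw [hZd]
    exact ContDiffBump.convolution_tendsto_right_of_continuous hφ hd q

end Mollify

/-- The weak inequality extends to `C^1` test functions. -/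
lemma IsWeakSolution.weak_ineq_of_contDiff_one {m : ℕ} {p : ℝ} (hp : 1 < p) {f h g : ℝ → ℝ}
    {u : Heis m → ℝ} (hu : IsWeakSolution (phiP p) f h g u) {ζ : Heis m → ℝ}
    (hζ : ContDiff ℝ 1 ζ) (hc : HasCompactSupport ζ) (h0 : ∀ q, 0 ≤ ζ q) :
    ∫ q, (f (u q) - h (u q) * g ‖gradH u q‖) * ζ q ≤
      -∫ q, inner ℝ (pField p (gradH u q)) (gradH ζ q) := by
  obtain ⟨Z, S, C, hS, hZ, hZ0, hZS, hZC, hZt, hZd⟩ := exists_smooth_approx volume ζ hζ hc h0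
  have hZc : ∀ n, HasCompactSupport (Z n) := fun n =>
    HasCompactSupport.intro hS fun q hq => (hZS n q hq).1
  have hA : Continuous fun q => pField p (gradH u q) :=
    (continuous_pField hp).comp (continuous_gradH hu.contDiff)
  have hlim1 : Tendsto (fun n => ∫ q, (f (u q) - h (u q) * g ‖gradH u q‖) * Z n q) atTop
      (𝓝 (∫ q, (f (u q) - h (u q) * g ‖gradH u q‖) * ζ q)) := by
    refine tendsto_integral_of_dominated_convergence
      (S.indicator fun q => ‖f (u q) - h (u q) * g ‖gradH u q‖‖ * C) (fun n => ?_) ?_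
      (fun n => Eventually.of_forall fun q => ?_)
      (Eventually.of_forall fun q => (hZt q).const_mul _)
    · exact hu.locallyIntegrable.aestronglyMeasurable.mul (hZ n).continuous.aestronglyMeasurable
    · exact (integrable_indicator_iff hS.measurableSet).2
        ((hu.locallyIntegrable.integrableOn_isCompact hS).norm.mul_const C)
    · by_cases hq : q ∈ S
      · rw [indicator_of_mem hq, norm_mul]
        exact mul_le_mul_of_nonneg_left (hZC n q).1 (norm_nonneg _)
      · rw [indicator_of_notMem hq, (hZS n q hq).1]; simp
  -- The coefficients of the frame grow with `q`, so a uniform bound needs compactness of `S` times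
  -- a ball of covectors.
  obtain ⟨D, hD⟩ : ∃ D, ∀ q ∈ S, ∀ l : Heis m →L[ℝ] ℝ, ‖l‖ ≤ C → ‖horiz q l‖ ≤ D := by
    obtain ⟨D, hD⟩ := (hS.prod (isCompact_closedBall (0 : Heis m →L[ℝ] ℝ) C)
      ).exists_bound_of_continuousOn continuous_uncurry_horiz.continuousOn
    exact ⟨D, fun q hq l hl => hD (q, l) ⟨hq, by simpa using hl⟩⟩
  have hlim2 : Tendsto (fun n => ∫ q, inner ℝ (pField p (gradH u q)) (gradH (Z n) q)) atTop
      (𝓝 (∫ q, inner ℝ (pField p (gradH u q)) (gradH ζ q))) := by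
    refine tendsto_integral_of_dominated_convergence
      (S.indicator fun q => ‖pField p (gradH u q)‖ * D) (fun n => ?_) ?_
      (fun n => Eventually.of_forall fun q => ?_)
      (Eventually.of_forall fun q => ?_)
    · exact (hA.inner (continuous_gradH ((hZ n).of_le (by simp)))).aestronglyMeasurable
    · exact (integrable_indicator_iff hS.measurableSet).2
        ((hA.norm.mul continuous_const).continuousOn.integrableOn_compact hS)
    · by_cases hq : q ∈ S
      · rw [indicator_of_mem hq]
        exact (norm_inner_le_norm _ _).trans
          (mul_le_mul_of_nonneg_left (hD q hq _ (hZC n q).2) (norm_nonneg _))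
      · rw [indicator_of_notMem hq, gradH_eq_horiz _ q, gradH_eq_horiz _ q, (hZS n q hq).2]
        simp
    · exact tendsto_const_nhds.inner
        ((continuous_uncurry_horiz.tendsto (q, fderiv ℝ ζ q)).comp
          (tendsto_const_nhds.prodMk_nhds (hZd q)))
  refine le_of_tendsto_of_tendsto' hlim1 hlim2.neg fun n => ?_
  refine (hu.weak_ineq (Z n) (hZ n) (hZc n) (hZ0 n)).trans_eq ?_
  simp only [pField, real_inner_smul_left]

/-! ### The Korányi gauge and its gradient field -/

variable {m : ℕ}

/-- `|z|^2 = |x|^2 + |y|^2`. -/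
def zsq (q : Heis m) : ℝ := ∑ j, (q.1 j ^ 2 + q.2.1 j ^ 2)

/-- The fourth power `|z|^4 + t^2` of the Korányi gauge. -/
def gaugeN (q : Heis m) : ℝ := zsq q ^ 2 + q.2.2 ^ 2

/-- A quarter of the horizontal gradient of `gaugeN`. -/
noncomputable def gaugeField (q : Heis m) : EuclideanSpace ℝ (Fin m ⊕ Fin m) :=
  WithLp.toLp 2 (Sum.elim (fun j => zsq q * q.1 j + q.2.2 * q.2.1 j)
    (fun j => zsq q * q.2.1 j - q.2.2 * q.1 j))

/-- `gaugeField` as a vector field on the underlying Euclidean space. -/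
def gaugeVec (q : Heis m) : Heis m :=
  (fun j => zsq q * q.1 j + q.2.2 * q.2.1 j, fun j => zsq q * q.2.1 j - q.2.2 * q.1 j,
    2 * q.2.2 * zsq q)

lemma zsq_nonneg (q : Heis m) : 0 ≤ zsq q := Finset.sum_nonneg fun _ _ => by positivity

lemma gaugeN_nonneg (q : Heis m) : 0 ≤ gaugeN q := by unfold gaugeN; positivity

lemma sq_zsq_le_gaugeN (q : Heis m) : zsq q ^ 2 ≤ gaugeN q := by
  unfold gaugeN; nlinarith [sq_nonneg q.2.2]

@[fun_prop] lemma contDiff_zsq {n : WithTop ℕ∞} : ContDiff ℝ n (zsq : Heis m → ℝ) := by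
  unfold zsq; fun_prop

@[fun_prop] lemma contDiff_gaugeN {n : WithTop ℕ∞} : ContDiff ℝ n (gaugeN : Heis m → ℝ) := by
  unfold gaugeN; fun_prop

@[fun_prop] lemma continuous_zsq : Continuous (zsq : Heis m → ℝ) :=
  (contDiff_zsq (n := 1)).continuous

@[fun_prop] lemma continuous_gaugeN : Continuous (gaugeN : Heis m → ℝ) :=
  (contDiff_gaugeN (n := 1)).continuous

lemma isCompact_gaugeN_le (L : ℝ) : IsCompact {q : Heis m | gaugeN q ≤ L} := by
  refine Metric.isCompact_of_isClosed_isBounded (isClosed_le continuous_gaugeN continuous_const)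
    ((Metric.isBounded_closedBall (x := (0 : Heis m)) (r := 1 + L)).subset fun q hq => ?_)
  have hN : gaugeN q ≤ L := hq
  have hL : 0 ≤ L := (gaugeN_nonneg q).trans hN
  have hz : zsq q ≤ 1 + L := by nlinarith [sq_zsq_le_gaugeN q, sq_nonneg (zsq q - 1)]
  have hj : ∀ j, q.1 j ^ 2 + q.2.1 j ^ 2 ≤ zsq q := fun j =>
    Finset.single_le_sum (f := fun j => q.1 j ^ 2 + q.2.1 j ^ 2)
      (fun _ _ => by positivity) (Finset.mem_univ j)
  have ht : q.2.2 ^ 2 ≤ L := by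
    refine le_trans ?_ hN; unfold gaugeN; nlinarith [sq_nonneg (zsq q)]
  have habs : ∀ s : ℝ, s ^ 2 ≤ 1 + L → |s| ≤ 1 + L := fun s hs =>
    abs_le_of_sq_le_sq (by nlinarith) (by linarith)
  rw [mem_closedBall_zero_iff, Prod.norm_def, Prod.norm_def]
  refine max_le ((pi_norm_le_iff_of_nonneg (by linarith)).2 fun j => ?_)
    (max_le ((pi_norm_le_iff_of_nonneg (by linarith)).2 fun j => ?_) ?_)
  · exact habs _ (by nlinarith [hj j, sq_nonneg (q.2.1 j)])
  · exact habs _ (by nlinarith [hj j, sq_nonneg (q.1 j)])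
  · exact habs _ (by linarith)

lemma fderiv_zsq (q v : Heis m) :
    fderiv ℝ zsq q v = ∑ j, (2 * q.1 j * v.1 j + 2 * q.2.1 j * v.2.1 j) := by
  have h : HasFDerivAt (zsq : Heis m → ℝ)
      (∑ j, ((2 * q.1 j) • (ContinuousLinearMap.proj (R := ℝ) (φ := fun _ => ℝ) j ∘L
          ContinuousLinearMap.fst ℝ (Fin m → ℝ) ((Fin m → ℝ) × ℝ)) +
        (2 * q.2.1 j) • (ContinuousLinearMap.proj (R := ℝ) (φ := fun _ => ℝ) j ∘L
          ContinuousLinearMap.fst ℝ (Fin m → ℝ) ℝ ∘L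
            ContinuousLinearMap.snd ℝ (Fin m → ℝ) ((Fin m → ℝ) × ℝ)))) q := by
    refine HasFDerivAt.fun_sum fun j _ => HasFDerivAt.add ?_ ?_
    · have := (ContinuousLinearMap.proj (R := ℝ) (φ := fun _ => ℝ) j ∘L
          ContinuousLinearMap.fst ℝ (Fin m → ℝ) ((Fin m → ℝ) × ℝ)).hasFDerivAt (x := q) |>.pow 2
      simpa using this
    · have := (ContinuousLinearMap.proj (R := ℝ) (φ := fun _ => ℝ) j ∘L
          ContinuousLinearMap.fst ℝ (Fin m → ℝ) ℝ ∘L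
            ContinuousLinearMap.snd ℝ (Fin m → ℝ) ((Fin m → ℝ) × ℝ)).hasFDerivAt (x := q) |>.pow 2
      simpa using this
  rw [h.fderiv]
  simp

lemma differentiable_zsq : Differentiable ℝ (zsq : Heis m → ℝ) :=
  (contDiff_zsq (n := 1)).differentiable one_ne_zero

lemma differentiable_gaugeN : Differentiable ℝ (gaugeN : Heis m → ℝ) :=
  (contDiff_gaugeN (n := 1)).differentiable one_ne_zero

lemma fderiv_gaugeN (q v : Heis m) :
    fderiv ℝ gaugeN q v = 2 * zsq q * fderiv ℝ zsq q v + 2 * q.2.2 * v.2.2 := by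
  have h2 : HasFDerivAt (fun q : Heis m => q.2.2) (ContinuousLinearMap.snd ℝ (Fin m → ℝ) ℝ ∘L
      ContinuousLinearMap.snd ℝ (Fin m → ℝ) ((Fin m → ℝ) × ℝ)) q :=
    (ContinuousLinearMap.snd ℝ (Fin m → ℝ) ℝ ∘L
      ContinuousLinearMap.snd ℝ (Fin m → ℝ) ((Fin m → ℝ) × ℝ)).hasFDerivAt
  have h : HasFDerivAt gaugeN _ q := ((differentiable_zsq q).hasFDerivAt.pow 2).add (h2.pow 2)
  rw [h.fderiv]
  simp

lemma gradH_gaugeN (q : Heis m) : gradH gaugeN q = (4 : ℝ) • gaugeField q := by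
  ext i
  rcases i with j | j <;>
    simp [gradH, fieldX, fieldY, gaugeField, fderiv_gaugeN, fderiv_zsq, Pi.single_apply] <;> ring

lemma fderiv_zsq_gaugeVec (q : Heis m) : fderiv ℝ zsq q (gaugeVec q) = 2 * zsq q ^ 2 := by
  have h : 2 * zsq q ^ 2 = ∑ j, 2 * zsq q * (q.1 j ^ 2 + q.2.1 j ^ 2) := by
    rw [← Finset.mul_sum, ← zsq.eq_def]; ring
  rw [fderiv_zsq, h]
  refine Finset.sum_congr rfl fun j _ => ?_
  simp only [gaugeVec]
  ring

lemma fderiv_gaugeN_gaugeVec (q : Heis m) :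
    fderiv ℝ gaugeN q (gaugeVec q) = 4 * zsq q * gaugeN q := by
  rw [fderiv_gaugeN, fderiv_zsq_gaugeVec, gaugeN]
  simp only [gaugeVec]
  ring

/-- In each pair of components the mixed terms `±2 |z|^2 t x_j y_j` cancel. -/
lemma norm_gaugeField_sq (q : Heis m) : ‖gaugeField q‖ ^ 2 = zsq q * gaugeN q := by
  rw [EuclideanSpace.norm_sq_eq, Fintype.sum_sum_type, ← Finset.sum_add_distrib]
  simp only [gaugeField, Sum.elim_inl, Sum.elim_inr, Real.norm_eq_abs, sq_abs]
  have : ∀ j, (zsq q * q.1 j + q.2.2 * q.2.1 j) ^ 2 + (zsq q * q.2.1 j - q.2.2 * q.1 j) ^ 2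
      = (q.1 j ^ 2 + q.2.1 j ^ 2) * gaugeN q := fun j => by rw [gaugeN]; ring
  simp_rw [this]
  rw [← Finset.sum_mul, zsq]

lemma heis_eq_sum (v : Heis m) :
    v = (∑ j, (v.1 j • ((Pi.single j 1, 0, 0) : Heis m) +
      v.2.1 j • ((0, Pi.single j 1, 0) : Heis m))) + v.2.2 • ((0, 0, 1) : Heis m) := by
  refine Prod.ext ?_ (Prod.ext ?_ ?_)
  · ext i; simp [Prod.fst_sum, Finset.sum_apply, Pi.single_apply]
  · ext i; simp [Prod.snd_sum, Prod.fst_sum, Finset.sum_apply, Pi.single_apply]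
  · simp [Prod.snd_sum]

lemma clm_apply_eq_sum (l : Heis m →L[ℝ] ℝ) (v : Heis m) :
    l v = (∑ j, (v.1 j * l (Pi.single j 1, 0, 0) + v.2.1 j * l (0, Pi.single j 1, 0))) +
      v.2.2 * l (0, 0, 1) := by
  conv_lhs => rw [heis_eq_sum v]
  simp only [map_add, map_sum, map_smul, smul_eq_mul]

/-- `gaugeVec` is the combination of the `X_j`, `Y_j` with coefficients `gaugeField`; its
`t`-component is `∑ (2 y_j a_j - 2 x_j b_j) = 2 t |z|^2`. This turns horizontal pairings into
Euclidean directional derivatives, which can be integrated by parts. -/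
lemma inner_gaugeField_horiz (q : Heis m) (l : Heis m →L[ℝ] ℝ) :
    inner ℝ (gaugeField q) (horiz q l) = l (gaugeVec q) := by
  have hX : ∀ j, l (Pi.single j 1, 0, 2 * q.2.1 j) =
      l (Pi.single j 1, 0, 0) + 2 * q.2.1 j * l (0, 0, 1) := fun j => by
    rw [← smul_eq_mul (2 * q.2.1 j) (l _), ← map_smul, ← map_add]; simp
  have hY : ∀ j, l (0, Pi.single j 1, -(2 * q.1 j)) =
      l (0, Pi.single j 1, 0) - 2 * q.1 j * l (0, 0, 1) := fun j => by
    rw [← smul_eq_mul (2 * q.1 j) (l _), ← map_smul, ← map_sub]; simp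
  rw [clm_apply_eq_sum l (gaugeVec q), PiLp.inner_apply, Fintype.sum_sum_type,
    ← Finset.sum_add_distrib]
  simp only [gaugeField, horiz, Sum.elim_inl, Sum.elim_inr, hX, hY, gaugeVec]
  conv_rhs => rw [zsq.eq_def q]
  have : 2 * q.2.2 * (∑ j, (q.1 j ^ 2 + q.2.1 j ^ 2)) * l (0, 0, 1) =
      ∑ j, 2 * q.2.2 * (q.1 j ^ 2 + q.2.1 j ^ 2) * l (0, 0, 1) := by
    rw [Finset.mul_sum, Finset.sum_mul]
  rw [this, ← Finset.sum_add_distrib, ← zsq.eq_def q]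
  refine Finset.sum_congr rfl fun j _ => ?_
  simp only [RCLike.inner_apply, conj_trivial]
  ring

/-! ### Integration by parts -/

section Parts

lemma integrable_mul_of_hasCompactSupport {E : Type*} [NormedAddCommGroup E] [MeasurableSpace E]
    [BorelSpace E] {μ : Measure E} [IsFiniteMeasureOnCompacts μ] {a ζ : E → ℝ} (ha : Continuous a)
    (hζ : Continuous ζ) (hc : HasCompactSupport ζ) : Integrable (fun q => a q * ζ q) μ :=
  (ha.mul hζ).integrable_of_hasCompactSupport hc.mul_left

variable {E : Type*} [NormedAddCommGroup E] [NormedSpace ℝ E] [MeasurableSpace E]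
  [BorelSpace E] {μ : Measure E} [μ.IsAddHaarMeasure]

lemma integrable_mul_fderiv {a ζ : E → ℝ} (ha : Continuous a) (hζ : ContDiff ℝ 1 ζ)
    (hc : HasCompactSupport ζ) (v : E) : Integrable (fun q => a q * fderiv ℝ ζ q v) μ :=
  integrable_mul_of_hasCompactSupport ha
    ((hζ.continuous_fderiv one_ne_zero).clm_apply continuous_const) (hc.fderiv_apply (𝕜 := ℝ) v)

lemma integrable_fderiv_mul {a ζ : E → ℝ} (ha : ContDiff ℝ 1 a) (hζ : Continuous ζ)
    (hc : HasCompactSupport ζ) (v : E) : Integrable (fun q => fderiv ℝ a q v * ζ q) μ :=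
  integrable_mul_of_hasCompactSupport
    ((ha.continuous_fderiv one_ne_zero).clm_apply continuous_const) hζ hc

lemma integral_mul_fderiv_eq_neg [FiniteDimensional ℝ E] {a ζ : E → ℝ} (ha : ContDiff ℝ 1 a) (hζ : ContDiff ℝ 1 ζ)
    (hc : HasCompactSupport ζ) (v : E) :
    ∫ q, a q * fderiv ℝ ζ q v ∂μ = -∫ q, fderiv ℝ a q v * ζ q ∂μ :=
  integral_mul_fderiv_eq_neg_fderiv_mul_of_integrable
    (integrable_fderiv_mul ha hζ.continuous hc v) (integrable_mul_fderiv ha.continuous hζ hc v)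
    (integrable_mul_of_hasCompactSupport ha.continuous hζ.continuous hc)
    (fun x _ => ha.differentiable one_ne_zero x) (fun x _ => hζ.differentiable one_ne_zero x)

end Parts

/-- Integration by parts along a vector field with `C^1` coefficients. -/
lemma integral_fderiv_vec {V : Heis m → Heis m} (hV : ContDiff ℝ 1 V) {ζ : Heis m → ℝ}
    (hζ : ContDiff ℝ 1 ζ) (hc : HasCompactSupport ζ) :
    ∫ q, fderiv ℝ ζ q (V q) =
      -∫ q, ((∑ j, (fderiv ℝ (fun q => (V q).1 j) q (Pi.single j 1, 0, 0) +
        fderiv ℝ (fun q => (V q).2.1 j) q (0, Pi.single j 1, 0))) +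
        fderiv ℝ (fun q => (V q).2.2) q (0, 0, 1)) * ζ q := by
  have h1 : ∀ j, ContDiff ℝ 1 fun q => (V q).1 j := fun j => by fun_prop
  have h2 : ∀ j, ContDiff ℝ 1 fun q => (V q).2.1 j := fun j => by fun_prop
  have h3 : ContDiff ℝ 1 fun q => (V q).2.2 := by fun_prop
  have i1 := fun j => integrable_mul_fderiv (μ := volume) (h1 j).continuous hζ hc
    (Pi.single j 1, 0, 0)
  have i2 := fun j => integrable_mul_fderiv (μ := volume) (h2 j).continuous hζ hc
    (0, Pi.single j 1, 0)
  have i3 := integrable_mul_fderiv (μ := volume) h3.continuous hζ hc (0, 0, 1)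
  have k1 := fun j => integrable_fderiv_mul (μ := volume) (h1 j) hζ.continuous hc
    (Pi.single j 1, 0, 0)
  have k2 := fun j => integrable_fderiv_mul (μ := volume) (h2 j) hζ.continuous hc
    (0, Pi.single j 1, 0)
  have k3 := integrable_fderiv_mul (μ := volume) h3 hζ.continuous hc (0, 0, 1)
  simp_rw [clm_apply_eq_sum (fderiv ℝ ζ _) (V _), add_mul, Finset.sum_mul, add_mul]
  rw [integral_add (integrable_finsetSum _ fun j _ => ?_) i3,
    integral_add (integrable_finsetSum _ fun j _ => ?_) k3,
    integral_finsetSum _ fun j _ => ?_, integral_finsetSum _ fun j _ => ?_, neg_add,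
    ← Finset.sum_neg_distrib, integral_mul_fderiv_eq_neg h3 hζ hc]
  · congr 1
    refine Finset.sum_congr rfl fun j _ => ?_
    rw [integral_add (i1 j) (i2 j), integral_add (k1 j) (k2 j),
      integral_mul_fderiv_eq_neg (h1 j) hζ hc, integral_mul_fderiv_eq_neg (h2 j) hζ hc, neg_add]
  all_goals first | exact (i1 j).add (i2 j) | exact (k1 j).add (k2 j)

@[fun_prop] lemma contDiff_gaugeVec {n : WithTop ℕ∞} : ContDiff ℝ n (gaugeVec : Heis m → Heis m) := by
  unfold gaugeVec
  fun_prop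

/-- Integration by parts for a multiple of the gauge field. -/
lemma integral_mul_inner_gaugeField {G : Heis m → ℝ} (hG : ContDiff ℝ 1 G) {ζ : Heis m → ℝ}
    (hζ : ContDiff ℝ 1 ζ) (hc : HasCompactSupport ζ) :
    ∫ q, G q * inner ℝ (gaugeField q) (gradH ζ q) =
      -∫ q, ((2 * m + 4) * zsq q * G q + fderiv ℝ G q (gaugeVec q)) * ζ q := by
  have h := integral_fderiv_vec (V := fun q => G q • gaugeVec q)
    (hG.smul contDiff_gaugeVec) hζ hc
  simp only [map_smul, smul_eq_mul] at h
  simp only [gradH_eq_horiz, inner_gaugeField_horiz]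
  rw [h]
  congr 2
  ext q
  congr 1
  have hG' := (hG.differentiable one_ne_zero q).hasFDerivAt
  have hz := (differentiable_zsq q).hasFDerivAt
  have hx : ∀ j, HasFDerivAt (fun q : Heis m => q.1 j)
      (ContinuousLinearMap.proj (R := ℝ) (φ := fun _ => ℝ) j ∘L
        ContinuousLinearMap.fst ℝ (Fin m → ℝ) ((Fin m → ℝ) × ℝ)) q :=
    fun j => (ContinuousLinearMap.proj (R := ℝ) (φ := fun _ => ℝ) j ∘L
      ContinuousLinearMap.fst ℝ (Fin m → ℝ) ((Fin m → ℝ) × ℝ)).hasFDerivAt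
  have hy : ∀ j, HasFDerivAt (fun q : Heis m => q.2.1 j)
      (ContinuousLinearMap.proj (R := ℝ) (φ := fun _ => ℝ) j ∘L
        ContinuousLinearMap.fst ℝ (Fin m → ℝ) ℝ ∘L
          ContinuousLinearMap.snd ℝ (Fin m → ℝ) ((Fin m → ℝ) × ℝ)) q :=
    fun j => (ContinuousLinearMap.proj (R := ℝ) (φ := fun _ => ℝ) j ∘L
      ContinuousLinearMap.fst ℝ (Fin m → ℝ) ℝ ∘L
        ContinuousLinearMap.snd ℝ (Fin m → ℝ) ((Fin m → ℝ) × ℝ)).hasFDerivAt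
  have ht : HasFDerivAt (fun q : Heis m => q.2.2) (ContinuousLinearMap.snd ℝ (Fin m → ℝ) ℝ ∘L
      ContinuousLinearMap.snd ℝ (Fin m → ℝ) ((Fin m → ℝ) × ℝ)) q :=
    (ContinuousLinearMap.snd ℝ (Fin m → ℝ) ℝ ∘L
      ContinuousLinearMap.snd ℝ (Fin m → ℝ) ((Fin m → ℝ) × ℝ)).hasFDerivAt
  have e1 : ∀ j v, fderiv ℝ (fun q => (G q • gaugeVec q).1 j) q v = G q *
      (fderiv ℝ zsq q v * q.1 j + zsq q * v.1 j + v.2.2 * q.2.1 j + q.2.2 * v.2.1 j) +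
      (gaugeVec q).1 j * fderiv ℝ G q v := fun j v => by
    rw [HasFDerivAt.fderiv (f := fun q => (G q • gaugeVec q).1 j)
      (hG'.mul ((hz.mul (hx j)).add (ht.mul (hy j))))]
    simp [gaugeVec]
    ring
  have e2 : ∀ j v, fderiv ℝ (fun q => (G q • gaugeVec q).2.1 j) q v = G q *
      (fderiv ℝ zsq q v * q.2.1 j + zsq q * v.2.1 j - v.2.2 * q.1 j - q.2.2 * v.1 j) +
      (gaugeVec q).2.1 j * fderiv ℝ G q v := fun j v => by
    rw [HasFDerivAt.fderiv (f := fun q => (G q • gaugeVec q).2.1 j)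
      (hG'.mul ((hz.mul (hy j)).sub (ht.mul (hx j))))]
    simp [gaugeVec]
    exact Or.inl (by ring)
  have e3 : ∀ v, fderiv ℝ (fun q => (G q • gaugeVec q).2.2) q v = G q *
      (2 * v.2.2 * zsq q + 2 * q.2.2 * fderiv ℝ zsq q v) +
      (gaugeVec q).2.2 * fderiv ℝ G q v := fun v => by
    rw [HasFDerivAt.fderiv (f := fun q => (G q • gaugeVec q).2.2)
      (hG'.mul ((ht.const_mul 2).mul hz))]
    simp [gaugeVec]
    ring
  have z1 : ∀ j, fderiv ℝ zsq q (Pi.single j 1, 0, 0) = 2 * q.1 j := fun j => by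
    simp [fderiv_zsq, Pi.single_apply]
  have z2 : ∀ j, fderiv ℝ zsq q (0, Pi.single j 1, 0) = 2 * q.2.1 j := fun j => by
    simp [fderiv_zsq, Pi.single_apply]
  have z3 : fderiv ℝ zsq q (0, 0, 1) = 0 := by simp [fderiv_zsq]
  -- The divergence of `gaugeVec` is `(2m + 4) |z|^2`: the `x` and `y` directions contribute `2m +
  -- 2`, the `t` direction contributes 2.
  have hsum : (2 * m + 2) * zsq q * G q = ∑ j, (G q * (2 * q.1 j * q.1 j + zsq q) +
      G q * (2 * q.2.1 j * q.2.1 j + zsq q)) := by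
    have : ∀ j, G q * (2 * q.1 j * q.1 j + zsq q) + G q * (2 * q.2.1 j * q.2.1 j + zsq q) =
        2 * G q * (q.1 j ^ 2 + q.2.1 j ^ 2) + 2 * G q * zsq q := fun j => by ring
    simp_rw [this]
    rw [Finset.sum_add_distrib, ← Finset.mul_sum, ← zsq.eq_def]
    simp
    ring
  have hsplit : (2 * m + 4) * zsq q * G q = (2 * m + 2) * zsq q * G q + 2 * zsq q * G q := by ring
  rw [clm_apply_eq_sum (fderiv ℝ G q) (gaugeVec q), hsplit, hsum]
  simp only [e1, e2, e3, z1, z2, z3, Pi.single_eq_same, Pi.zero_apply]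
  rw [add_add_add_comm, ← Finset.sum_add_distrib]
  congr 1
  · refine Finset.sum_congr rfl fun j _ => ?_
    ring
  · ring

/-! ### The `p`-Laplacian of gauge powers -/

lemma norm_gaugeField (q : Heis m) : ‖gaugeField q‖ = Real.sqrt (zsq q * gaugeN q) := by
  rw [← norm_gaugeField_sq, Real.sqrt_sq (norm_nonneg _)]

lemma gradH_const_add_rpow {lam : ℝ} (hlam : 1 ≤ lam) (b c : ℝ) (q : Heis m) :
    gradH (fun q => b + c * gaugeN q ^ lam) q =
      (c * (lam * gaugeN q ^ (lam - 1)) * 4) • gaugeField q := by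
  have h : HasFDerivAt (fun q : Heis m => b + c * gaugeN q ^ lam)
      (c • ((lam * gaugeN q ^ (lam - 1)) • fderiv ℝ gaugeN q)) q :=
    (((Real.hasDerivAt_rpow_const (Or.inr hlam)).comp_hasFDerivAt q
      (differentiable_gaugeN q).hasFDerivAt).const_mul c).const_add b
  rw [gradH_eq_horiz, h.fderiv, horiz_smul, horiz_smul, ← gradH_eq_horiz, gradH_gaugeN, smul_smul,
    smul_smul]

/-- The `p`-Laplacian flux of a power of the gauge. -/
lemma pField_gradH_rpow {p lam : ℝ} (hlam : 1 ≤ lam) (b : ℝ) {c : ℝ} (hc : 0 < c)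
    (q : Heis m) :
    pField p (gradH (fun q => b + c * gaugeN q ^ lam) q) =
      ((4 * c * lam) ^ (p - 1) * (gaugeN q ^ ((lam - 1 / 2) * (p - 1) - 1 / 2) *
        zsq q ^ ((p - 2) / 2))) • gaugeField q := by
  rw [gradH_const_add_rpow hlam]
  -- Both sides vanish where the field does; elsewhere `zsq` and `gaugeN` are positive and real
  -- powers can be combined freely.
  rcases eq_or_ne (gaugeField q) 0 with h0 | h0
  · simp [h0, pField]
  have hn := norm_pos_iff.2 h0
  have hprod : 0 < zsq q * gaugeN q := by
    rw [← norm_gaugeField_sq]; positivity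
  have hz : 0 < zsq q := lt_of_le_of_ne (zsq_nonneg q) fun h => by simp [← h] at hprod
  have hN : 0 < gaugeN q := pos_of_mul_pos_right hprod hz.le
  rw [pField_smul (by positivity), pField_eq_smul h0, smul_smul]
  congr 1
  rw [norm_gaugeField, Real.sqrt_eq_rpow, ← Real.rpow_mul hprod.le, Real.mul_rpow hz.le hN.le,
    show c * (lam * gaugeN q ^ (lam - 1)) * 4 = (4 * c * lam) * gaugeN q ^ (lam - 1) by ring,
    Real.mul_rpow (by positivity) (by positivity), ← Real.rpow_mul hN.le]
  have : gaugeN q ^ ((lam - 1 / 2) * (p - 1) - 1 / 2) =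
      gaugeN q ^ ((lam - 1) * (p - 1)) * gaugeN q ^ (1 / 2 * (p - 2)) := by
    rw [← Real.rpow_add hN]; congr 1; ring
  rw [this, show (p - 2) / 2 = 1 / 2 * (p - 2) by ring]
  ring

/-- The coefficient of the regularised flux. -/
noncomputable def fluxCoeff (p μ d : ℝ) (q : Heis m) : ℝ :=
  gaugeN q ^ μ * (zsq q + d) ^ ((p - 2) / 2)

/-- The shift `d > 0` removes the singularity of `|z|^(p-2)` on the axis `z = 0`, and `μ ≥ 1` gives
smoothness at the origin, so integration by parts applies. -/
lemma contDiff_fluxCoeff (p : ℝ) {μ d : ℝ} (hμ : 1 ≤ μ) (hd : 0 < d) :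
    ContDiff ℝ 1 (fluxCoeff (m := m) p μ d) := by
  refine ContDiff.mul ?_ ?_
  · exact (Real.contDiff_rpow_const_of_le (n := 1) (by simpa using hμ)).comp contDiff_gaugeN
  · exact (contDiff_zsq.add contDiff_const).rpow_const_of_ne fun q => by
      have := zsq_nonneg q; positivity

lemma fderiv_fluxCoeff_gaugeVec (p : ℝ) {μ d : ℝ} (hμ : 1 ≤ μ) (hd : 0 < d) (q : Heis m) :
    fderiv ℝ (fluxCoeff p μ d) q (gaugeVec q) =
      (zsq q + d) ^ ((p - 2) / 2) * gaugeN q ^ μ * zsq q *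
        (4 * μ + (p - 2) * (zsq q / (zsq q + d))) := by
  have hpos : 0 < zsq q + d := by have := zsq_nonneg q; positivity
  have h1 : HasFDerivAt (fun q : Heis m => gaugeN q ^ μ) _ q :=
    (Real.hasDerivAt_rpow_const (Or.inr hμ)).comp_hasFDerivAt q
      (differentiable_gaugeN q).hasFDerivAt
  have h2 : HasFDerivAt (fun q : Heis m => (zsq q + d) ^ ((p - 2) / 2)) _ q :=
    ((differentiable_zsq q).hasFDerivAt.add_const d).rpow_const (Or.inl hpos.ne')
  rw [HasFDerivAt.fderiv (f := fluxCoeff p μ d) (h1.mul h2)]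
  simp only [add_apply, smul_apply, smul_eq_mul,
    fderiv_zsq_gaugeVec, fderiv_gaugeN_gaugeVec]
  have e1 : gaugeN q ^ (μ - 1) * gaugeN q = gaugeN q ^ μ := by
    rcases (gaugeN_nonneg q).eq_or_lt with h | h
    · rw [← h, Real.zero_rpow (by linarith : μ ≠ 0), mul_zero]
    · rw [← Real.rpow_add_one h.ne']; ring_nf
  rw [Real.rpow_sub_one hpos.ne', ← e1]
  field_simp
  ring

/-- The left side is the divergence of the regularised flux. The quotient `zsq / (zsq + d)` lies in
`[0, 1]`, so the bound has a constant independent of `d`. -/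
lemma div_flux_le (p : ℝ) (hp : 1 < p) {μ d : ℝ} (hμ : 1 ≤ μ) (hd : 0 < d) (q : Heis m) :
    (2 * m + 4) * zsq q * fluxCoeff p μ d q + fderiv ℝ (fluxCoeff p μ d) q (gaugeVec q) ≤
      (4 * μ + 2 * m + 4 + p) * ((zsq q + d) ^ (p / 2) * gaugeN q ^ μ) := by
  have hz := zsq_nonneg q
  have hpos : 0 < zsq q + d := by positivity
  rw [fderiv_fluxCoeff_gaugeVec p hμ hd, fluxCoeff]
  have hk : (zsq q + d) ^ (p / 2) = (zsq q + d) ^ ((p - 2) / 2) * (zsq q + d) := by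
    rw [← Real.rpow_add_one hpos.ne']; congr 1; ring
  have hN : 0 ≤ gaugeN q ^ μ := Real.rpow_nonneg (gaugeN_nonneg q) _
  have hk0 : 0 ≤ (zsq q + d) ^ ((p - 2) / 2) := by positivity
  have hr0 : 0 ≤ zsq q / (zsq q + d) := by positivity
  have hr1 : zsq q / (zsq q + d) ≤ 1 := (div_le_one hpos).2 (by linarith)
  have hle : (p - 2) * (zsq q / (zsq q + d)) ≤ p := by nlinarith
  calc _ = (zsq q + d) ^ ((p - 2) / 2) * gaugeN q ^ μ * zsq q *
        (4 * μ + 2 * m + 4 + (p - 2) * (zsq q / (zsq q + d))) := by ring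
    _ ≤ (zsq q + d) ^ ((p - 2) / 2) * gaugeN q ^ μ * (zsq q + d) * (4 * μ + 2 * m + 4 + p) := by
        have hc : 0 ≤ 4 * μ + 2 * m + 4 + p := by positivity
        have hkN := mul_nonneg hk0 hN
        exact (mul_le_mul_of_nonneg_left (by linarith) (mul_nonneg hkN hz)).trans
          (mul_le_mul_of_nonneg_right (mul_le_mul_of_nonneg_left (by linarith) hkN) hc)
    _ = _ := by rw [hk]; ring

/-- On the support of `ζ` one has `|z|^2 ≤ √L` and `N ≤ L`, which makes the divergence bound
constant. -/
lemma integral_flux_le {p : ℝ} (hp : 1 < p) {μ d L : ℝ} (hμ : 1 ≤ μ) (hd : 0 < d) (hL : 0 < L)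
    {ζ : Heis m → ℝ} (hζ : ContDiff ℝ 1 ζ) (hc : HasCompactSupport ζ) (h0 : ∀ q, 0 ≤ ζ q)
    (hζL : ∀ q, L < gaugeN q → ζ q = 0) :
    -∫ q, fluxCoeff p μ d q * inner ℝ (gaugeField q) (gradH ζ q) ≤
      (4 * μ + 2 * m + 4 + p) * ((Real.sqrt L + d) ^ (p / 2) * L ^ μ) * ∫ q, ζ q := by
  have hG := contDiff_fluxCoeff (m := m) p hμ hd
  rw [integral_mul_inner_gaugeField hG hζ hc, neg_neg, ← integral_const_mul]
  have hμ0 : 0 ≤ μ := by linarith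
  have hD : Continuous fun q : Heis m => (2 * m + 4) * zsq q * fluxCoeff p μ d q +
      fderiv ℝ (fluxCoeff p μ d) q (gaugeVec q) :=
    ((continuous_const.mul continuous_zsq).mul hG.continuous).add
      ((hG.continuous_fderiv one_ne_zero).clm_apply (contDiff_gaugeVec (n := 1)).continuous)
  refine integral_mono (integrable_mul_of_hasCompactSupport hD hζ.continuous hc)
    ((hζ.continuous.integrable_of_hasCompactSupport hc).const_mul _) fun q => ?_
  rcases lt_or_ge L (gaugeN q) with h | h
  · simp [hζL q h]
  · refine mul_le_mul_of_nonneg_right ((div_flux_le p hp hμ hd q).trans ?_) (h0 q)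
    have hz : zsq q ≤ Real.sqrt L := Real.le_sqrt_of_sq_le ((sq_zsq_le_gaugeN q).trans h)
    have hz0 := zsq_nonneg q
    have hN0 := gaugeN_nonneg q
    gcongr

/-- Powers of the gauge are weak supersolutions with bounded right-hand side. -/
lemma neg_integral_pField_rpow_le {p : ℝ} (hp : 1 < p) {lam μ L : ℝ} (hlam : 1 ≤ lam)
    (hμ : μ = (lam - 1 / 2) * (p - 1) - 1 / 2) (hμ1 : 1 ≤ μ) (b : ℝ) {c : ℝ} (hc : 0 < c)
    (hL : 0 < L) {ζ : Heis m → ℝ} (hζ : ContDiff ℝ 1 ζ) (hcs : HasCompactSupport ζ)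
    (h0 : ∀ q, 0 ≤ ζ q) (hζL : ∀ q, L < gaugeN q → ζ q = 0) :
    -∫ q, inner ℝ (pField p (gradH (fun q => b + c * gaugeN q ^ lam) q)) (gradH ζ q) ≤
      (4 * c * lam) ^ (p - 1) * ((4 * μ + 2 * m + 4 + p) * L ^ (μ + p / 4)) * ∫ q, ζ q := by
  have hcl : 0 ≤ (4 * c * lam) ^ (p - 1) := by positivity
  have hlim : Tendsto (fun d => ∫ q, fluxCoeff p μ d q * inner ℝ (gaugeField q) (gradH ζ q))
      (𝓝[>] 0) (𝓝 (∫ q, fluxCoeff p μ 0 q * inner ℝ (gaugeField q) (gradH ζ q))) := by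
    refine tendsto_integral_filter_of_dominated_convergence
      (fun q => gaugeN q ^ μ * (zsq q + 1) ^ ((p - 1) / 2) * Real.sqrt (gaugeN q) * ‖gradH ζ q‖)
      ?_ ?_ ?_ ?_
    · filter_upwards [self_mem_nhdsWithin] with d hd
      have hi : Continuous fun q : Heis m => inner ℝ (gaugeField q) (gradH ζ q) := by
        simp only [gradH_eq_horiz, inner_gaugeField_horiz]
        exact (hζ.continuous_fderiv one_ne_zero).clm_apply
          (contDiff_gaugeVec (n := 1)).continuous
      exact ((contDiff_fluxCoeff p hμ1 hd).continuous.mul hi).aestronglyMeasurable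
    · filter_upwards [self_mem_nhdsWithin, Ioc_mem_nhdsGT (zero_lt_one' ℝ)] with d hd hd1
      refine Eventually.of_forall fun q => ?_
      have hz := zsq_nonneg q
      have hN := gaugeN_nonneg q
      have hd0 : 0 < d := hd
      have hpos : 0 < zsq q + d := by positivity
      -- The factor `√zsq` from `‖gaugeField q‖` raises the exponent from `(p-2)/2`, possibly
      -- negative, to `(p-1)/2 > 0`; this makes the domination uniform in `d`.
      have hk : (zsq q + d) ^ ((p - 2) / 2) * Real.sqrt (zsq q) ≤ (zsq q + 1) ^ ((p - 1) / 2) :=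
        calc _ ≤ (zsq q + d) ^ ((p - 2) / 2) * Real.sqrt (zsq q + d) := by gcongr; linarith
          _ = (zsq q + d) ^ ((p - 1) / 2) := by
            rw [Real.sqrt_eq_rpow, ← Real.rpow_add hpos]; congr 1; ring
          _ ≤ _ := Real.rpow_le_rpow hpos.le (by linarith [hd1.2]) (by linarith)
      have hNμ : 0 ≤ gaugeN q ^ μ := Real.rpow_nonneg hN _
      rw [norm_mul, fluxCoeff, Real.norm_of_nonneg (by positivity)]
      calc _ ≤ gaugeN q ^ μ * (zsq q + d) ^ ((p - 2) / 2) * (‖gaugeField q‖ * ‖gradH ζ q‖) :=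
            mul_le_mul_of_nonneg_left (norm_inner_le_norm _ _) (by positivity)
        _ = gaugeN q ^ μ * ((zsq q + d) ^ ((p - 2) / 2) * Real.sqrt (zsq q)) *
            Real.sqrt (gaugeN q) * ‖gradH ζ q‖ := by
            rw [norm_gaugeField, Real.sqrt_mul hz]; ring
        _ ≤ _ := by gcongr
    · refine integrable_mul_of_hasCompactSupport (((Continuous.rpow_const continuous_gaugeN
        fun _ => Or.inr (by linarith)).mul (Continuous.rpow_const
          (continuous_zsq.add continuous_const) fun _ => Or.inr (by linarith))).mul
        continuous_gaugeN.sqrt) (continuous_gradH hζ).norm (hasCompactSupport_gradH hcs).norm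
    · refine Eventually.of_forall fun q => ?_
      rcases eq_or_ne (gaugeField q) 0 with h | h
      · simp [h]
      · have hz : zsq q ≠ 0 := fun hz => h <| by
          rw [← norm_eq_zero, norm_gaugeField, hz, zero_mul, Real.sqrt_zero]
        refine Tendsto.mul_const _ (Tendsto.const_mul _ (tendsto_nhdsWithin_of_tendsto_nhds ?_))
        exact ((continuous_const.add continuous_id).continuousAt.rpow_const
          (Or.inl (by simpa using hz))).tendsto
  have hlim2 : Tendsto (fun d : ℝ => (4 * μ + 2 * m + 4 + p) *
      ((Real.sqrt L + d) ^ (p / 2) * L ^ μ) * ∫ q, ζ q) (𝓝[>] 0)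
      (𝓝 ((4 * μ + 2 * m + 4 + p) * ((Real.sqrt L + 0) ^ (p / 2) * L ^ μ) * ∫ q, ζ q)) := by
    refine tendsto_nhdsWithin_of_tendsto_nhds (Continuous.tendsto ?_ 0)
    have : Continuous fun d : ℝ => (Real.sqrt L + d) ^ (p / 2) :=
      (continuous_const.add continuous_id).rpow_const fun _ => Or.inr (by linarith)
    fun_prop
  have hle := le_of_tendsto_of_tendsto hlim.neg hlim2 <| by
    filter_upwards [self_mem_nhdsWithin] with d hd
    exact integral_flux_le hp hμ1 hd hL hζ hcs h0 hζL
  have hL' : (Real.sqrt L + 0) ^ (p / 2) * L ^ μ = L ^ (μ + p / 4) := by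
    rw [add_zero, Real.sqrt_eq_rpow, ← Real.rpow_mul hL.le, ← Real.rpow_add hL]; congr 1; ring
  rw [hL'] at hle
  have hrw : ∀ q, inner ℝ (pField p (gradH (fun q => b + c * gaugeN q ^ lam) q)) (gradH ζ q) =
      (4 * c * lam) ^ (p - 1) * (fluxCoeff p μ 0 q * inner ℝ (gaugeField q) (gradH ζ q)) :=
    fun q => by
      rw [pField_gradH_rpow hlam b hc, real_inner_smul_left, fluxCoeff, hμ, add_zero]; ring
  simp_rw [hrw]
  rw [integral_const_mul, ← mul_neg, mul_assoc (_ ^ (p - 1)) _ (∫ q, ζ q)]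
  exact mul_le_mul_of_nonneg_left hle hcl

/-! ### Absorbing the gradient term -/

lemma deriv_phiP {p t : ℝ} (ht : 0 < t) : deriv (phiP p) t = (p - 1) * t ^ (p - 2) := by
  have h : HasDerivAt (phiP p) _ t := Real.hasDerivAt_rpow_const (Or.inl ht.ne')
  rw [h.deriv, show p - 1 - 1 = p - 2 by ring]

/-- Taking `s = 1` suffices for `r > 0`, as `t^2 φ'(t) = (p - 1) t^p`; the value at 0 needs `s = 0`.
-/
lemma CondG.exists_le_rpow {p : ℝ} (hp : 1 < p) {g : ℝ → ℝ} (hG : CondG (phiP p) 0 g) :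
    ∃ C : ℝ, 0 < C ∧ ∀ r, 0 ≤ r → g r ≤ C * r ^ p := by
  obtain ⟨D, hD, h⟩ := hG
  have hp1 : 0 < p - 1 := sub_pos.2 hp
  refine ⟨D * (p - 1), by positivity, fun r hr => ?_⟩
  rcases hr.eq_or_lt with rfl | hr
  · have := h 0 (by simp) 1 one_pos
    simpa [Real.zero_rpow (by linarith : p ≠ 0)] using this
  · have := h 1 (by simp) r hr
    rw [one_mul, Real.one_rpow, mul_one, deriv_phiP hr] at this
    refine this.trans_eq ?_
    rw [show r ^ p = r ^ (2 : ℝ) * r ^ (p - 2) by rw [← Real.rpow_add hr]; ring_nf, Real.rpow_two]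
    ring

/-- A change of the unknown `u ↦ Ψ u`, `Ψ' = j`, that absorbs the gradient term `C h(u) |∇u|^p`. -/
structure IsGradTransform (p C : ℝ) (h j Ψ : ℝ → ℝ) (M : ℝ) : Prop where
  hasDerivAt : ∀ s, HasDerivAt Ψ (j s) s
  continuous : Continuous j
  pos : ∀ s, 0 < j s
  one_le : ∀ s, 0 ≤ s → 1 ≤ j s
  hasDerivAt_rpow : ∀ s, 0 < s →
    HasDerivAt (fun s => j s ^ (p - 1)) (C * h s * j s ^ (p - 1)) s
  self_le : ∀ s, 0 ≤ s → s ≤ Ψ s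
  le_mul : ∀ s, 0 ≤ s → Ψ s ≤ M * s
  one_le_const : 1 ≤ M

lemma exists_isGradTransform {p C : ℝ} (hp : 1 < p) (hC : 0 ≤ C) {h : ℝ → ℝ} (hH : CondH h)
    (hL1 : IntegrableOn h (Ioi 0) volume) : ∃ j Ψ M, IsGradTransform p C h j Ψ M := by
  have hp1 : 0 < p - 1 := sub_pos.2 hp
  -- Extending `h` by 0 to `s ≤ 0` gives a primitive, hence `j` and `Ψ`, on the whole line, whatever
  -- `h` does at 0.
  let k : ℝ → ℝ := (Ioi 0).indicator h
  have hk : Integrable k := (integrable_indicator_iff measurableSet_Ioi).2 hL1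
  have hk0 : ∀ s, 0 ≤ k s := indicator_nonneg hH.nonneg
  let H : ℝ → ℝ := fun s => ∫ r in (0 : ℝ)..s, k r
  have hHc : Continuous H := hk.continuous_primitive 0
  have hH0 : ∀ s, 0 ≤ s → 0 ≤ H s := fun s hs =>
    intervalIntegral.integral_nonneg hs fun r _ => hk0 r
  have hH1 : ∀ s, 0 ≤ s → H s ≤ ∫ r, k r := fun s hs => by
    simp only [H, intervalIntegral.integral_of_le hs]
    exact setIntegral_le_integral hk (Eventually.of_forall hk0)
  have hHd : ∀ s, 0 < s → HasDerivAt H (h s) s := fun s hs => by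
    have hks : k s = h s := indicator_of_mem hs h
    have hcont : ContinuousOn k (Ioi 0) := hH.continuousOn.congr fun r hr => indicator_of_mem hr h
    rw [← hks]
    exact intervalIntegral.integral_hasDerivAt_right hk.intervalIntegrable
      (hcont.stronglyMeasurableAtFilter isOpen_Ioi s hs) (hcont.continuousAt (Ioi_mem_nhds hs))
  -- The exponent is dictated by `(j^(p-1))' = C h j^(p-1)`; the total integral of `h` bounds `j`
  -- and yields `M`.
  let j : ℝ → ℝ := fun s => Real.exp (C / (p - 1) * H s)
  have hj : Continuous j := by fun_prop
  have hjp : ∀ s, j s ^ (p - 1) = Real.exp (C * H s) := fun s => by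
    rw [← Real.exp_mul]; congr 1; field_simp
  have hj1 : ∀ s, 0 ≤ s → 1 ≤ j s := fun s hs => Real.one_le_exp (by have := hH0 s hs; positivity)
  have hjM : ∀ s, 0 ≤ s → j s ≤ Real.exp (C / (p - 1) * ∫ r, k r) := fun s hs =>
    Real.exp_le_exp.2 (mul_le_mul_of_nonneg_left (hH1 s hs) (by positivity))
  refine ⟨j, fun s => ∫ r in (0 : ℝ)..s, j r, Real.exp (C / (p - 1) * ∫ r, k r),
    fun s => (hj.integral_hasStrictDerivAt 0 s).hasDerivAt, hj, fun s => Real.exp_pos _, hj1,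
    fun s hs => ?_, fun s hs => ?_, fun s hs => ?_, (hj1 0 le_rfl).trans (hjM 0 le_rfl)⟩
  · simp_rw [hjp]
    convert ((hHd s hs).const_mul C).exp using 1
    ring
  · have := intervalIntegral.integral_mono_on hs (intervalIntegrable_const (μ := volume) (c := (1 : ℝ)))
      (hj.intervalIntegrable 0 s) fun r hr => hj1 r hr.1
    simpa using this
  · have := intervalIntegral.integral_mono_on hs (hj.intervalIntegrable 0 s)
      (intervalIntegrable_const (μ := volume) (c := Real.exp (C / (p - 1) * ∫ r, k r))) fun r hr => hjM r hr.1
    simpa [mul_comm] using this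

lemma IsGradTransform.contDiff {p C M : ℝ} {h j Ψ : ℝ → ℝ} (T : IsGradTransform p C h j Ψ M) :
    ContDiff ℝ 1 Ψ :=
  contDiff_one_iff_deriv.2 ⟨fun s => (T.hasDerivAt s).differentiableAt, by
    rw [funext fun s => (T.hasDerivAt s).deriv]; exact T.continuous⟩

/-- Only on `(0, ∞)`, because the derivative contains `h`, which may blow up at 0. -/
lemma IsGradTransform.contDiffOn_rpow {p C M : ℝ} {h j Ψ : ℝ → ℝ} (T : IsGradTransform p C h j Ψ M)
    (hH : ContinuousOn h (Ioi 0)) : ContDiffOn ℝ 1 (fun s => j s ^ (p - 1)) (Ioi 0) := by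
  rw [show (1 : WithTop ℕ∞) = 0 + 1 by simp, contDiffOn_succ_iff_deriv_of_isOpen isOpen_Ioi]
  refine ⟨fun s hs => (T.hasDerivAt_rpow s hs).differentiableAt.differentiableWithinAt, by simp, ?_⟩
  rw [contDiffOn_zero]
  refine ContinuousOn.congr (f := fun s => C * h s * j s ^ (p - 1)) ?_
    fun s hs => (T.hasDerivAt_rpow s hs).deriv
  exact (continuousOn_const.mul hH).mul
    (T.continuous.rpow_const fun s => Or.inl (T.pos s).ne').continuousOn

lemma IsGradTransform.map_zero {p C M : ℝ} {h j Ψ : ℝ → ℝ} (T : IsGradTransform p C h j Ψ M) :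
    Ψ 0 = 0 :=
  le_antisymm (by simpa using T.le_mul 0 le_rfl) (T.self_le 0 le_rfl)

/-! ### The comparison principle on gauge balls -/

section Comparison

variable {v w : Heis m → ℝ} {L : ℝ}

/-- The test function `χ(v - w)` cut off outside the sublevel set `{N < L}` of the gauge. -/
noncomputable def cutTest (v w : Heis m → ℝ) (L : ℝ) (q : Heis m) : ℝ :=
  open Classical in if gaugeN q < L then expNegInvGlue (v q - w q) else 0

lemma cutTest_nonneg (q : Heis m) : 0 ≤ cutTest v w L q := by
  unfold cutTest; split_ifs
  exacts [expNegInvGlue.nonneg _, le_rfl]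

lemma cutTest_eq_zero_of_le {q : Heis m} (h : v q ≤ w q) : cutTest v w L q = 0 := by
  unfold cutTest; split_ifs
  exacts [expNegInvGlue.zero_of_nonpos (by linarith), rfl]

lemma cutTest_eq_zero_of_lt {q : Heis m} (h : L < gaugeN q) : cutTest v w L q = 0 := by
  rw [cutTest, if_neg h.not_gt]

lemma hasCompactSupport_cutTest : HasCompactSupport (cutTest v w L) :=
  HasCompactSupport.intro (isCompact_gaugeN_le L) fun _ hq => cutTest_eq_zero_of_lt (not_le.1 hq)

lemma cutTest_eventuallyEq_of_lt (hv : Continuous v) (hw : Continuous w) {q : Heis m}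
    (h : v q < w q) : cutTest v w L =ᶠ[𝓝 q] 0 := by
  filter_upwards [hv.continuousAt.eventually_lt hw.continuousAt h] with x hx
  exact cutTest_eq_zero_of_le hx.le

lemma cutTest_eventuallyEq_zero (hv : Continuous v) (hw : Continuous w)
    (hb : ∀ q, gaugeN q = L → v q < w q) {q : Heis m} (hq : L ≤ gaugeN q) :
    cutTest v w L =ᶠ[𝓝 q] 0 := by
  rcases hq.eq_or_lt with h | h
  · exact cutTest_eventuallyEq_of_lt hv hw (hb q h.symm)
  · filter_upwards [continuous_gaugeN.continuousAt.eventually (lt_mem_nhds h)] with x hx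
    exact cutTest_eq_zero_of_lt hx

lemma cutTest_eventuallyEq {q : Heis m} (hq : gaugeN q < L) :
    cutTest v w L =ᶠ[𝓝 q] fun x => expNegInvGlue (v x - w x) := by
  filter_upwards [continuous_gaugeN.continuousAt.eventually (gt_mem_nhds hq)] with x hx
  rw [cutTest, if_pos hx]

/-- The strict inequality `v < w` on `{N = L}` makes the test function vanish near that set, so the
cutoff creates no jump. -/
lemma contDiff_cutTest (hv : ContDiff ℝ 1 v) (hw : ContDiff ℝ 1 w)
    (hb : ∀ q, gaugeN q = L → v q < w q) : ContDiff ℝ 1 (cutTest v w L) := by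
  refine contDiff_iff_contDiffAt.2 fun q => ?_
  rcases lt_or_ge (gaugeN q) L with h | h
  · exact ((expNegInvGlue.contDiff (n := 1)).comp (hv.sub hw)).contDiffAt.congr_of_eventuallyEq
      (cutTest_eventuallyEq h)
  · exact contDiffAt_const.congr_of_eventuallyEq
      (cutTest_eventuallyEq_zero hv.continuous hw.continuous hb h)

/-- The factor is `χ'(v - w) ≥ 0` inside the ball, `χ` being increasing, and 0 outside; this sign is
what lets monotonicity of the flux act. -/
lemma exists_gradH_cutTest (hv : ContDiff ℝ 1 v) (hw : ContDiff ℝ 1 w)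
    (hb : ∀ q, gaugeN q = L → v q < w q) (q : Heis m) :
    ∃ s : ℝ, 0 ≤ s ∧ gradH (cutTest v w L) q = s • (gradH v q - gradH w q) := by
  rcases lt_or_ge (gaugeN q) L with h | h
  · refine ⟨deriv expNegInvGlue (v q - w q), expNegInvGlue.monotone.deriv_nonneg, ?_⟩
    have hd : HasFDerivAt (fun x => expNegInvGlue (v x - w x))
        (deriv expNegInvGlue (v q - w q) • (fderiv ℝ v q - fderiv ℝ w q)) q :=
      ((expNegInvGlue.contDiff (n := 1)).differentiable one_ne_zero _).hasDerivAt.comp_hasFDerivAt q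
        ((hv.differentiable one_ne_zero q).hasFDerivAt.sub
          (hw.differentiable one_ne_zero q).hasFDerivAt)
    rw [gradH_eq_horiz, (hd.congr_of_eventuallyEq (cutTest_eventuallyEq h)).fderiv, horiz_smul,
      horiz_sub]
    rfl
  · refine ⟨0, le_rfl, ?_⟩
    rw [gradH_eq_horiz, (cutTest_eventuallyEq_zero hv.continuous hw.continuous hb h).fderiv_eq]
    simp

lemma pField_inner_gradH_cutTest_le {p : ℝ} (hp : 1 < p) (hv : ContDiff ℝ 1 v) (hw : ContDiff ℝ 1 w)
    (hb : ∀ q, gaugeN q = L → v q < w q) (q : Heis m) :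
    inner ℝ (pField p (gradH w q)) (gradH (cutTest v w L) q) ≤
      inner ℝ (pField p (gradH v q)) (gradH (cutTest v w L) q) := by
  obtain ⟨s, hs, h⟩ := exists_gradH_cutTest hv hw hb q
  have := inner_pField_sub_nonneg hp (gradH v q) (gradH w q)
  rw [inner_sub_left] at this
  rw [h, real_inner_smul_right, real_inner_smul_right]
  exact mul_le_mul_of_nonneg_left (by linarith) hs

end Comparison

lemma continuous_inner_pField_gradH {p : ℝ} (hp : 1 < p) {u ζ : Heis m → ℝ} (hu : ContDiff ℝ 1 u)
    (hζ : ContDiff ℝ 1 ζ) : Continuous fun q => inner ℝ (pField p (gradH u q)) (gradH ζ q) :=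
  ((continuous_pField hp).comp (continuous_gradH hu)).inner (continuous_gradH hζ)

lemma integrable_inner_pField_gradH {p : ℝ} (hp : 1 < p) {u ζ : Heis m → ℝ} (hu : ContDiff ℝ 1 u)
    (hζ : ContDiff ℝ 1 ζ) (hc : HasCompactSupport ζ) :
    Integrable fun q => inner ℝ (pField p (gradH u q)) (gradH ζ q) :=
  (continuous_inner_pField_gradH hp hu hζ).integrable_of_hasCompactSupport <|
    (hasCompactSupport_gradH hc).mono fun q hq => by
      contrapose! hq
      simp only [Function.mem_support, not_not] at hq ⊢
      rw [hq, inner_zero_right]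

/-- Testing the weak inequality with `j(u)^(p-1) χ(Ψ(u) - w)` removes the gradient term. -/
lemma integral_transform_le {p C M L b : ℝ} (hp : 1 < p) {f h g j Ψ : ℝ → ℝ} (hF : CondF f)
    (hH : CondH h) (hg : ∀ r, 0 ≤ r → g r ≤ C * r ^ p) (T : IsGradTransform p C h j Ψ M)
    {u w : Heis m → ℝ} (hu : IsWeakSolution (phiP p) f h g u) (hu0 : ∀ q, 0 ≤ u q)
    (hw : ContDiff ℝ 1 w) (hb : 0 < b) (hwb : ∀ q, b ≤ w q)
    (hbd : ∀ q, gaugeN q = L → Ψ (u q) < w q) :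
    f (b / M) * ∫ q, cutTest (fun q => Ψ (u q)) w L q ≤
      -∫ q, inner ℝ (pField p (gradH w q)) (gradH (cutTest (fun q => Ψ (u q)) w L) q) := by
  have hM : 0 < M := one_pos.trans_le T.one_le_const
  set v : Heis m → ℝ := fun q => Ψ (u q) with hvdef
  have hud := hu.contDiff
  have hv : ContDiff ℝ 1 v := T.contDiff.comp hud
  set ζ₀ := cutTest v w L with hζ₀def
  have hζ₀ : ContDiff ℝ 1 ζ₀ := contDiff_cutTest hv hw hbd
  have hζ₀0 : ∀ q, 0 ≤ ζ₀ q := cutTest_nonneg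
  have hζ₀c : HasCompactSupport ζ₀ := hasCompactSupport_cutTest
  let ζ : Heis m → ℝ := fun q => j (u q) ^ (p - 1) * ζ₀ q
  have hJ : ∀ q, 1 ≤ j (u q) ^ (p - 1) := fun q =>
    Real.one_le_rpow (T.one_le _ (hu0 q)) (by linarith)
  -- Since `w ≥ b > 0`, the test function vanishes near zeros of `u`, so the singularity of `h` at 0
  -- is never met.
  have hnear : ∀ q, u q = 0 → ζ₀ =ᶠ[𝓝 q] 0 := fun q hq =>
    cutTest_eventuallyEq_of_lt hv.continuous hw.continuous <| by
      simp only [hvdef, hq, T.map_zero]; linarith [hwb q]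
  have hζ : ContDiff ℝ 1 ζ := by
    refine contDiff_iff_contDiffAt.2 fun q => ?_
    rcases (hu0 q).eq_or_lt with h0 | h0
    · refine (contDiffAt_const (c := (0 : ℝ))).congr_of_eventuallyEq ?_
      filter_upwards [hnear q h0.symm] with x hx
      simp [ζ, hx]
    · exact (((T.contDiffOn_rpow hH.continuousOn).contDiffAt (Ioi_mem_nhds h0)).comp q
        hud.contDiffAt).mul hζ₀.contDiffAt
  have hζc : HasCompactSupport ζ := hζ₀c.mul_left
  -- Paired with the flux of `u`, the first term gives `C h(u) j^(p-1) |∇u|^p ζ₀`, which dominates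
  -- the gradient term; the second gives the flux of `v = Ψ(u)`.
  have hgrad : ∀ q, gradH ζ q = (ζ₀ q * (C * h (u q) * j (u q) ^ (p - 1))) • gradH u q +
      (j (u q) ^ (p - 1)) • gradH ζ₀ q := fun q => by
    rcases (hu0 q).eq_or_lt with h0 | h0
    · have h1 : ζ =ᶠ[𝓝 q] 0 := by
        filter_upwards [hnear q h0.symm] with x hx
        simp [ζ, hx]
      have h2 := hnear q h0.symm
      rw [gradH_eq_horiz ζ, gradH_eq_horiz ζ₀, h1.fderiv_eq, h2.fderiv_eq, h2.eq_of_nhds]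
      simp
    · have hd : HasFDerivAt ζ _ q :=
        ((T.hasDerivAt_rpow _ h0).comp_hasFDerivAt q
          (hud.differentiable one_ne_zero q).hasFDerivAt).mul
          (hζ₀.differentiable one_ne_zero q).hasFDerivAt
      rw [gradH_eq_horiz ζ, hd.fderiv, add_comm, horiz_add, horiz_smul, horiz_smul, horiz_smul,
        smul_smul]
      rfl
  have hgradv : ∀ q, pField p (gradH v q) = (j (u q) ^ (p - 1)) • pField p (gradH u q) :=
    fun q => by
      have hd : HasFDerivAt v (j (u q) • fderiv ℝ u q) q :=
        (T.hasDerivAt (u q)).comp_hasFDerivAt q (hud.differentiable one_ne_zero q).hasFDerivAt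
      rw [gradH_eq_horiz v, hd.fderiv, horiz_smul, pField_smul (T.pos _)]
      rfl
  have hweak := hu.weak_ineq_of_contDiff_one hp hζ hζc fun q =>
    mul_nonneg (zero_le_one.trans (hJ q)) (hζ₀0 q)
  have i1 : Integrable fun q => (f (u q) - h (u q) * g ‖gradH u q‖) * ζ q :=
    hu.locallyIntegrable.integrable_smul_right_of_hasCompactSupport hζ.continuous hζc
  have i2 := integrable_inner_pField_gradH hp hud hζ hζc
  have i3 := (hζ₀.continuous.integrable_of_hasCompactSupport hζ₀c (μ := volume)).const_mul
    (f (b / M))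
  have i4 := integrable_inner_pField_gradH hp hw hζ₀ hζ₀c
  have hmono := integral_mono (i3.add i4) (i1.add i2) fun q => ?_
  · rw [integral_add' i1 i2, integral_add' i3 i4, integral_const_mul] at hmono
    linarith
  · have hA := pField_inner_gradH_cutTest_le hp hv hw hbd q
    rw [hgradv, real_inner_smul_left] at hA
    simp only [Pi.add_apply]
    rw [hgrad, inner_add_right, real_inner_smul_right, real_inner_smul_right, inner_pField_self hp]
    rcases (hζ₀0 q).eq_or_lt with h0 | h0
    · simp only [ζ, ← h0]
      linarith
    · have hvw : w q < v q := by
        by_contra hle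
        exact h0.ne' (cutTest_eq_zero_of_le (not_lt.1 hle))
      -- Where `ζ₀ > 0`: `b ≤ w < v ≤ M u`.
      have hub : b / M < u q := by
        rw [div_lt_iff₀' hM]
        linarith [hwb q, T.le_mul _ (hu0 q)]
      have hbM : 0 < b / M := by positivity
      have hf1 : f (b / M) ≤ f (u q) := hF.monotoneOn hbM.le (hu0 q) hub.le
      have hf0 := hF.pos _ hbM
      have hh := hH.nonneg _ (hbM.trans hub)
      have hg1 := hg _ (norm_nonneg (gradH u q))
      have hJ0 : 0 ≤ j (u q) ^ (p - 1) := zero_le_one.trans (hJ q)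
      have t1 : f (b / M) * ζ₀ q ≤ f (u q) * (j (u q) ^ (p - 1) * ζ₀ q) := by
        refine mul_le_mul hf1 ?_ h0.le (hf0.le.trans hf1)
        nlinarith [hJ q]
      have t2 : h (u q) * g ‖gradH u q‖ * (j (u q) ^ (p - 1) * ζ₀ q) ≤
          ζ₀ q * (C * h (u q) * j (u q) ^ (p - 1)) * ‖gradH u q‖ ^ p :=
        calc _ ≤ h (u q) * (C * ‖gradH u q‖ ^ p) * (j (u q) ^ (p - 1) * ζ₀ q) := by gcongr
          _ = _ := by ring
      simp only [ζ]
      linarith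

/-- Comparison with powers of the gauge on its sublevel sets. -/
lemma comparison {p C M L b c lam μ : ℝ} (hp : 1 < p) {f h g j Ψ : ℝ → ℝ} (hF : CondF f)
    (hH : CondH h) (hg : ∀ r, 0 ≤ r → g r ≤ C * r ^ p) (T : IsGradTransform p C h j Ψ M)
    {u : Heis m → ℝ} (hu : IsWeakSolution (phiP p) f h g u) (hu0 : ∀ q, 0 ≤ u q)
    (hb : 0 < b) (hc : 0 < c) (hL : 0 < L) (hlam : 1 ≤ lam)
    (hμ : μ = (lam - 1 / 2) * (p - 1) - 1 / 2) (hμ1 : 1 ≤ μ)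
    (hκ : (4 * c * lam) ^ (p - 1) * ((4 * μ + 2 * m + 4 + p) * L ^ (μ + p / 4)) < f (b / M))
    (hbd : ∀ q, gaugeN q = L → Ψ (u q) < b + c * L ^ lam) {q : Heis m} (hq : gaugeN q < L) :
    Ψ (u q) ≤ b + c * gaugeN q ^ lam := by
  let w : Heis m → ℝ := fun q => b + c * gaugeN q ^ lam
  have hw : ContDiff ℝ 1 w := contDiff_const.add (contDiff_const.mul
    ((Real.contDiff_rpow_const_of_le (n := 1) (by simpa using hlam)).comp contDiff_gaugeN))
  have hwb : ∀ q, b ≤ w q := fun q =>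
    le_add_of_nonneg_right (mul_nonneg hc.le (Real.rpow_nonneg (gaugeN_nonneg q) _))
  have hbd' : ∀ q, gaugeN q = L → Ψ (u q) < w q := fun q hq => by
    simp only [w, hq]; exact hbd q hq
  have hζ : ContDiff ℝ 1 (cutTest (fun q => Ψ (u q)) w L) :=
    contDiff_cutTest (T.contDiff.comp hu.contDiff) hw hbd'
  have h1 := integral_transform_le hp hF hH hg T hu hu0 hw hb hwb hbd'
  have h2 := neg_integral_pField_rpow_le hp hlam hμ hμ1 b hc hL hζ hasCompactSupport_cutTest
    cutTest_nonneg fun q => cutTest_eq_zero_of_lt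
  -- The two estimates read `f(b / M) I ≤ κ I` with `κ < f(b / M)`, which excludes `I > 0`.
  have h3 : ∫ q, cutTest (fun q => Ψ (u q)) w L q = 0 := by
    refine le_antisymm ?_ (integral_nonneg cutTest_nonneg)
    by_contra! h
    exact absurd (h1.trans h2) (not_le.2 (mul_lt_mul_of_pos_right hκ h))
  rw [integral_eq_zero_iff_of_nonneg cutTest_nonneg
    (hζ.continuous.integrable_of_hasCompactSupport hasCompactSupport_cutTest),
    hζ.continuous.ae_eq_iff_eq _ continuous_zero] at h3
  have h4 := congrFun h3 q
  rw [cutTest, if_pos hq, Pi.zero_apply, expNegInvGlue.zero_iff_nonpos] at h4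
  linarith

/-! ### The Keller-Osserman condition for `φ(t) = t^(p-1)` -/

lemma K_phiP {p t : ℝ} (hp : 1 < p) (ht : 0 ≤ t) : K (phiP p) t = (p - 1) / p * t ^ p := by
  have h : K (phiP p) t = ∫ s in (0 : ℝ)..t, (p - 1) * s ^ (p - 1) := by
    unfold K
    refine intervalIntegral.integral_congr_uIoo fun s hs => ?_
    rw [uIoo_of_le ht] at hs
    simp only [deriv_phiP hs.1]
    rw [show p - 1 = (p - 2) + 1 by ring, Real.rpow_add_one hs.1.ne']
    ring
  rw [h, intervalIntegral.integral_const_mul, integral_rpow (Or.inl (by linarith))]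
  rw [sub_add_cancel, Real.zero_rpow (by linarith), sub_zero]
  ring

lemma Kinv_phiP {p s : ℝ} (hp : 1 < p) (hs : 0 ≤ s) :
    Kinv (phiP p) s = (p / (p - 1) * s) ^ (1 / p) := by
  have hp0 : 0 < p := by linarith
  have hp1 : 0 < p - 1 := by linarith
  have hex : ∃ r ∈ Ici (0 : ℝ), K (phiP p) r = s := by
    refine ⟨(p / (p - 1) * s) ^ (1 / p), Real.rpow_nonneg (by positivity) _, ?_⟩
    rw [K_phiP hp (Real.rpow_nonneg (by positivity) _), ← Real.rpow_mul (by positivity),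
      one_div_mul_cancel hp0.ne', Real.rpow_one]
    field_simp
  have h1 : K (phiP p) (Kinv (phiP p) s) = s := Function.invFunOn_eq hex
  have h0 : 0 ≤ Kinv (phiP p) s := Function.invFunOn_mem hex
  rw [K_phiP hp h0] at h1
  have h2 : p / (p - 1) * s = Kinv (phiP p) s ^ p := by
    generalize Kinv (phiP p) s ^ p = y at h1
    rw [← h1]; field_simp
  rw [h2, ← Real.rpow_mul h0, mul_one_div_cancel hp0.ne', Real.rpow_one]

lemma CondF.intervalIntegrable {f : ℝ → ℝ} (hF : CondF f) {a b : ℝ} (ha : 0 ≤ a) (hb : 0 ≤ b) :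
    IntervalIntegrable f volume a b :=
  (hF.continuousOn.mono fun _ hx => (le_inf ha hb).trans hx.1).intervalIntegrable

/-- This one-sided bound allows `F(t)` to be replaced by `t f(t)` in the integral, giving a monotone
integrand directly in terms of `f`. -/
lemma CondF.primF_le {f : ℝ → ℝ} (hF : CondF f) {t : ℝ} (ht : 0 ≤ t) : primF f t ≤ t * f t := by
  have := intervalIntegral.integral_mono_on ht (hF.intervalIntegrable le_rfl ht)
    (intervalIntegrable_const (μ := volume) (c := f t)) fun r hr => hF.monotoneOn hr.1 ht hr.2
  simpa [primF] using this

lemma CondF.primF_pos {f : ℝ → ℝ} (hF : CondF f) {t : ℝ} (ht : 0 < t) : 0 < primF f t :=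
  intervalIntegral.intervalIntegral_pos_of_pos_on (hF.intervalIntegrable le_rfl ht.le)
    (fun s hs => hF.pos s hs.1) ht

/-- The Keller-Osserman condition in dyadic form. -/
lemma KellerOsserman.summable {p : ℝ} (hp : 1 < p) {f : ℝ → ℝ} (hF : CondF f)
    (hKO : KellerOsserman (phiP p) f) :
    Summable fun k : ℕ => (((2 : ℝ) ^ k) ^ (p - 1) / f (2 ^ k)) ^ (1 / p) := by
  have hp0 : 0 < p := by linarith
  have hp1 : 0 < p - 1 := by linarith
  obtain ⟨s, hs, hint⟩ := hKO
  obtain ⟨r, hr⟩ := mem_atTop_sets.1 hs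
  obtain ⟨N, hN⟩ := exists_nat_ge (max r 1)
  have hNr : r ≤ N := (le_max_left _ _).trans hN
  have hN1 : (1 : ℝ) ≤ N := (le_max_right _ _).trans hN
  have hint' := hint.mono_set (t := s) (s := Ioi (N : ℝ)) fun t ht =>
    hr t (hNr.trans (le_of_lt ht))
  let ψ : ℝ → ℝ := fun t => (t * f t) ^ (-(1 / p))
  have hpos : ∀ t, 0 < t → 0 < t * f t := fun t ht => mul_pos ht (hF.pos t ht)
  have hanti : AntitoneOn ψ (Ioi 0) := fun a ha b hb hab => by
    refine Real.rpow_le_rpow_of_nonpos (hpos a ha) ?_ (neg_nonpos.2 (by positivity))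
    exact mul_le_mul hab (hF.monotoneOn (Ioi_subset_Ici_self ha) (Ioi_subset_Ici_self hb) hab)
      (hF.pos a ha).le (Ioi_subset_Ici_self hb)
  have hN0 : (0 : ℝ) < N := zero_lt_one.trans_le hN1
  have hψint : IntegrableOn ψ (Ioi N) := by
    refine Integrable.mono' (hint'.const_mul ((p / (p - 1)) ^ (1 / p))) ?_ ?_
    · refine ContinuousOn.aestronglyMeasurable ?_ measurableSet_Ioi
      exact (continuousOn_id.mul (hF.continuousOn.mono fun t ht =>
        Ioi_subset_Ici_self (hN0.trans ht))).rpow_const fun t ht => Or.inl (hpos t (hN0.trans ht)).ne'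
    · refine (ae_restrict_iff' measurableSet_Ioi).2 (Eventually.of_forall fun t ht => ?_)
      have ht0 : 0 < t := hN0.trans ht
      have hF0 := hF.primF_pos ht0
      rw [Real.norm_of_nonneg (Real.rpow_nonneg (hpos t ht0).le _), Kinv_phiP hp hF0.le,
        Real.mul_rpow (by positivity) hF0.le]
      have hc : 0 < (p / (p - 1)) ^ (1 / p) := by positivity
      have e : (p / (p - 1)) ^ (1 / p) * (1 / ((p / (p - 1)) ^ (1 / p) * primF f t ^ (1 / p))) =
          primF f t ^ (-(1 / p)) := by
        rw [Real.rpow_neg hF0.le]; field_simp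
      rw [e]
      exact Real.rpow_le_rpow_of_nonpos hF0 (hF.primF_le ht0.le) (neg_nonpos.2 (by positivity))
  have hψ0 : ∀ t, 0 ≤ t → 0 ≤ ψ t := fun t ht =>
    Real.rpow_nonneg (ht.eq_or_lt.elim (fun h => by simp [← h]) fun h => (hpos t h).le) _
  have hsum : Summable fun n : ℕ => ψ n :=
    (hanti.mono fun t ht => hN0.trans_le ht).summable_of_integrableOn_Ioi hψint
      fun t ht => hψ0 t (hN0.trans ht).le
  -- Cauchy condensation; the condensed term `2^k (2^k f(2^k))^(-1/p)` is the one wanted.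
  rw [← summable_condensed_iff_of_nonneg (fun n => hψ0 n n.cast_nonneg) fun a b ha hab =>
    hanti (mem_Ioi.2 (Nat.cast_pos.2 ha)) (mem_Ioi.2 (Nat.cast_pos.2 (ha.trans_le hab)))
      (Nat.cast_le.2 hab)] at hsum
  refine hsum.congr fun k => ?_
  have hx : (0 : ℝ) < 2 ^ k := by positivity
  have hy := hF.pos _ hx
  simp only [ψ, Nat.cast_pow, Nat.cast_ofNat]
  generalize (2 : ℝ) ^ k = x at hx hy
  have e : x ^ (p - 1) / f x = x ^ p * (x * f x)⁻¹ := by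
    rw [Real.rpow_sub_one hx.ne']; field_simp
  rw [e, Real.mul_rpow (x := x ^ p) (by positivity) (by positivity), ← Real.rpow_mul hx.le,
    mul_one_div_cancel hp0.ne', Real.rpow_one, Real.rpow_neg (by positivity),
    Real.inv_rpow (by positivity)]

/-! ### Non-existence: bounded solutions and the doubling iteration -/

/-- `comparison` with the boundary value normalised. -/
lemma comparison_of_lt {p C M b A L lam : ℝ} (hp : 1 < p) {f h g j Ψ : ℝ → ℝ} (hF : CondF f)
    (hH : CondH h) (hg : ∀ r, 0 ≤ r → g r ≤ C * r ^ p) (T : IsGradTransform p C h j Ψ M)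
    {u : Heis m → ℝ} (hu : IsWeakSolution (phiP p) f h g u) (hu0 : ∀ q, 0 ≤ u q)
    (hb : 0 < b) (hA : 0 < A) (hL : 0 < L) (hlam : 1 + 3 / (2 * (p - 1)) ≤ lam)
    (hκ : (4 * A * lam) ^ (p - 1) * ((4 * (p - 1) + 2 * m + 4 + p) * lam) * L ^ (-(p / 4)) <
      f (b / M))
    (hbd : ∀ q, gaugeN q = L → Ψ (u q) < b + A) {q : Heis m} (hq : gaugeN q < L) :
    Ψ (u q) ≤ b + A * (gaugeN q / L) ^ lam := by
  have hp1 : 0 < p - 1 := by linarith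
  have hlam1 : 1 ≤ lam := le_trans (by have : 0 < 3 / (2 * (p - 1)) := by positivity
                                       linarith) hlam
  -- The lower bound on `lam` is chosen for this: it gives `(lam - 1/2)(p - 1) ≥ (p - 1)/2 + 3/2`.
  have hμ1 : 1 ≤ (lam - 1 / 2) * (p - 1) - 1 / 2 := by
    have h1 : 3 / (2 * (p - 1)) * (p - 1) = 3 / 2 := by field_simp
    nlinarith
  have hcL : A * L ^ (-lam) * L ^ lam = A := by
    rw [mul_assoc, ← Real.rpow_add hL, neg_add_cancel, Real.rpow_zero, mul_one]
  have h := comparison hp hF hH hg T hu hu0 hb (c := A * L ^ (-lam)) (by positivity) hL hlam1 rfl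
    hμ1 (lt_of_le_of_lt ?_ hκ) (by rwa [hcL]) hq
  · refine h.trans_eq ?_
    rw [Real.div_rpow (gaugeN_nonneg q) hL.le, Real.rpow_neg hL.le]
    ring
  · have e1 : (4 * (A * L ^ (-lam)) * lam) ^ (p - 1) =
        (4 * A * lam) ^ (p - 1) * L ^ (-lam * (p - 1)) := by
      rw [Real.rpow_mul hL.le, ← Real.mul_rpow (by positivity) (by positivity)]
      congr 1; ring
    -- With `c = A L^(-lam)` the powers of `L` depending on `lam` cancel, leaving `L^(-p/4)`.
    have e2 : L ^ (-(p / 4)) = L ^ (-lam * (p - 1)) *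
        L ^ ((lam - 1 / 2) * (p - 1) - 1 / 2 + p / 4) := by
      rw [← Real.rpow_add hL]; congr 1; ring
    have e3 : 4 * ((lam - 1 / 2) * (p - 1) - 1 / 2) + 2 * m + 4 + p ≤
        (4 * (p - 1) + 2 * m + 4 + p) * lam := by
      have : (0 : ℝ) ≤ (2 * m + 4 + p) * (lam - 1) :=
        mul_nonneg (by positivity) (by linarith)
      nlinarith
    rw [e1, e2]
    calc _ = (4 * A * lam) ^ (p - 1) * (4 * ((lam - 1 / 2) * (p - 1) - 1 / 2) + 2 * m + 4 + p) *
          (L ^ (-lam * (p - 1)) * L ^ ((lam - 1 / 2) * (p - 1) - 1 / 2 + p / 4)) := by ring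
      _ ≤ _ := by gcongr

/-- A bounded non-negative solution vanishes. -/
lemma eq_zero_of_bounded {p C M A : ℝ} (hp : 1 < p) {f h g j Ψ : ℝ → ℝ} (hF : CondF f)
    (hH : CondH h) (hg : ∀ r, 0 ≤ r → g r ≤ C * r ^ p) (T : IsGradTransform p C h j Ψ M)
    {u : Heis m → ℝ} (hu : IsWeakSolution (phiP p) f h g u) (hu0 : ∀ q, 0 ≤ u q)
    (hA : ∀ q, Ψ (u q) < A) (q : Heis m) : u q = 0 := by
  by_contra hne
  have huq : 0 < u q := lt_of_le_of_ne (hu0 q) (Ne.symm hne)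
  have hv : 0 < Ψ (u q) := huq.trans_le (T.self_le _ huq.le)
  have hA0 : 0 < A := hv.trans (hA q)
  have hp1 : 0 < p - 1 := by linarith
  have hM : 0 < M := one_pos.trans_le T.one_le_const
  set lam := 1 + 3 / (2 * (p - 1)) with hlam
  have hlam0 : 0 < lam := by positivity
  -- As `L → ∞` comparison yields `Ψ (u q) ≤ b + o(1)`, impossible for `b` equal to half of a
  -- positive value.
  set b := Ψ (u q) / 2 with hb
  have hb0 : 0 < b := by positivity
  have l1 : Tendsto (fun L : ℝ => (4 * A * lam) ^ (p - 1) *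
      ((4 * (p - 1) + 2 * m + 4 + p) * lam) * L ^ (-(p / 4))) atTop (𝓝 0) := by
    simpa using (tendsto_rpow_neg_atTop (by positivity : 0 < p / 4)).const_mul
      ((4 * A * lam) ^ (p - 1) * ((4 * (p - 1) + 2 * m + 4 + p) * lam))
  have l2 : Tendsto (fun L : ℝ => A * (gaugeN q / L) ^ lam) atTop (𝓝 0) := by
    have : Tendsto (fun L : ℝ => (gaugeN q / L) ^ lam) atTop (𝓝 (0 ^ lam)) :=
      (tendsto_const_nhds.div_atTop tendsto_id).rpow_const (Or.inr hlam0.le)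
    simpa [Real.zero_rpow hlam0.ne'] using this.const_mul A
  obtain ⟨L, h1, h2, h3, h4⟩ := ((l1.eventually (gt_mem_nhds (hF.pos _ (div_pos hb0 hM)))).and
    ((l2.eventually (gt_mem_nhds hb0)).and ((eventually_gt_atTop 0).and
      (eventually_gt_atTop (gaugeN q))))).exists
  have := comparison_of_lt hp hF hH hg T hu hu0 hb0 hA0 h3 le_rfl h1
    (fun q' _ => (hA q').trans (by linarith)) h4
  linarith

/-- One doubling step. -/
lemma exists_doubling {p C M L r a : ℝ} (hp : 1 < p) {f h g j Ψ : ℝ → ℝ} (hF : CondF f)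
    (hH : CondH h) (hg : ∀ r, 0 ≤ r → g r ≤ C * r ^ p) (T : IsGradTransform p C h j Ψ M)
    {u : Heis m → ℝ} (hu : IsWeakSolution (phiP p) f h g u) (hu0 : ∀ q, 0 ≤ u q)
    (ha : 0 < a) (hL : 1 ≤ L) (hr : 0 < r) {lam : ℝ} (hlam : 1 + 3 / (2 * (p - 1)) ≤ lam)
    (hrl : r * lam = Real.log 5)
    (hκ : (8 * a * lam) ^ (p - 1) * ((4 * (p - 1) + 2 * m + 4 + p) * lam) < f (a / 2 / M))
    (hq : ∃ q, gaugeN q ≤ L ∧ a ≤ Ψ (u q)) :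
    ∃ q, gaugeN q ≤ L * Real.exp r ∧ 2 * a ≤ Ψ (u q) := by
  by_contra! hcon
  obtain ⟨q, hqL, hqa⟩ := hq
  have hp1 : 0 < p - 1 := by linarith
  have hlam0 : 0 < lam := lt_of_lt_of_le (by positivity) hlam
  have hL0 : 0 < L := by linarith
  have hL1 : 1 ≤ L * Real.exp r := one_le_mul_of_one_le_of_one_le hL (Real.one_le_exp hr.le)
  have hlt : L < L * Real.exp r := lt_mul_of_one_lt_right hL0 (Real.one_lt_exp_iff.2 hr)
  -- If doubling fails, `b = a/2` and `A = 2a` are admissible. As `e^(-r lam) = 1/5`, the barrier at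
  -- `q` is at most `a/2 + 2a/5 < a`.
  have h := comparison_of_lt hp hF hH hg T hu hu0 (half_pos ha) (A := 2 * a) (by positivity)
    (by positivity : 0 < L * Real.exp r) hlam ?_
    (fun q' hq' => (hcon q' hq'.le).trans (by linarith)) (hqL.trans_lt hlt)
  · have hle : (gaugeN q / (L * Real.exp r)) ^ lam ≤ 1 / 5 := by
      have h1 : gaugeN q / (L * Real.exp r) ≤ Real.exp (-r) := by
        rw [div_le_iff₀ (by positivity), Real.exp_neg]
        field_simp
        exact hqL
      refine (Real.rpow_le_rpow (div_nonneg (gaugeN_nonneg q) (by positivity)) h1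
        hlam0.le).trans_eq ?_
      rw [← Real.exp_mul, neg_mul, hrl, Real.exp_neg, Real.exp_log (by norm_num)]
      norm_num
    nlinarith
  · refine lt_of_le_of_lt ?_ hκ
    rw [show 4 * (2 * a) * lam = 8 * a * lam by ring]
    refine mul_le_of_le_one_right (by positivity) ?_
    exact Real.rpow_le_one_of_one_le_of_nonpos hL1 (by linarith)

/-- Under the Keller-Osserman condition the only non-negative solution is zero. -/
theorem eq_zero_of_kellerOsserman {p : ℝ} (hp : 1 < p) {f h g : ℝ → ℝ} (hF : CondF f)
    (hH : CondH h) (hL1 : IntegrableOn h (Ioi 0) volume) (hG : CondG (phiP p) 0 g)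
    (hKO : KellerOsserman (phiP p) f) {u : Heis m → ℝ} (hu : IsWeakSolution (phiP p) f h g u)
    (hu0 : ∀ q, 0 ≤ u q) (q : Heis m) : u q = 0 := by
  obtain ⟨C, hC, hg⟩ := hG.exists_le_rpow hp
  obtain ⟨j, Ψ, M, T⟩ := exists_isGradTransform hp hC.le hH hL1
  have hM : 0 < M := one_pos.trans_le T.one_le_const
  have hp0 : 0 < p := by linarith
  have hp1 : 0 < p - 1 := by linarith
  by_contra hne
  have hunb : ∀ A, ∃ q, A ≤ Ψ (u q) := by
    by_contra! hcon
    obtain ⟨A, hA⟩ := hcon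
    exact hne (eq_zero_of_bounded hp hF hH hg T hu hu0 hA q)
  set ρ : ℕ → ℝ := fun k => (((2 : ℝ) ^ k) ^ (p - 1) / f (2 ^ k)) ^ (1 / p) with hρ
  have hρs : Summable ρ := hKO.summable hp hF
  have hf : ∀ k : ℕ, 0 < f (2 ^ k) := fun k => hF.pos _ (by positivity)
  have hρ0 : ∀ k, 0 < ρ k := fun k => by have := hf k; positivity
  set C₁ : ℝ := (16 * M) ^ (p - 1) * (4 * (p - 1) + 2 * m + 4 + p) with hC₁
  have hC₁0 : 0 < C₁ := by positivity
  -- Normalised so that with `lam = ε / ρ k` and `a = 2M 2^k` the smallness condition reads `f(2^k)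
  -- / 2 < f(2^k)`; the step is then `r k = log 5 / lam`.
  set ε : ℝ := (1 / (2 * C₁)) ^ (1 / p) with hε
  have hε0 : 0 < ε := by positivity
  have hlog : 0 < Real.log 5 := Real.log_pos (by norm_num)
  set r : ℕ → ℝ := fun k => Real.log 5 / ε * ρ k with hr
  have hr0 : ∀ k, 0 < r k := fun k => by have := hρ0 k; positivity
  have hrs : Summable r := hρs.mul_left _
  -- Since `ρ k → 0`, the exponent `ε / ρ k` eventually exceeds the threshold for `lam`.
  obtain ⟨k₀, hk₀⟩ : ∃ k₀, ∀ k ≥ k₀, ρ k < ε / (1 + 3 / (2 * (p - 1))) :=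
    eventually_atTop.1 (hρs.tendsto_atTop_zero.eventually (gt_mem_nhds (by positivity)))
  have hstep : ∀ k ≥ k₀, ∀ L, 1 ≤ L → (∃ q, gaugeN q ≤ L ∧ 2 * M * 2 ^ k ≤ Ψ (u q)) →
      ∃ q, gaugeN q ≤ L * Real.exp (r k) ∧ 2 * M * 2 ^ (k + 1) ≤ Ψ (u q) := by
    intro k hk L hL hq
    have hρk := hρ0 k
    have hfk := hf k
    rw [show 2 * M * 2 ^ (k + 1) = 2 * (2 * M * 2 ^ k) by ring]
    refine exists_doubling hp hF hH hg T hu hu0 (by positivity) hL (hr0 k) (lam := ε / ρ k) ?_ ?_ ?_ hq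
    · rw [le_div_iff₀ hρk]
      have := (lt_div_iff₀ (by positivity)).1 (hk₀ k hk)
      linarith
    · simp only [hr]; field_simp
    · have e1 : 2 * M * 2 ^ k / 2 / M = 2 ^ k := by field_simp
      have e2 : (ε / ρ k) ^ p = f (2 ^ k) / (2 * C₁ * ((2 : ℝ) ^ k) ^ (p - 1)) := by
        rw [Real.div_rpow hε0.le hρk.le, hε, hρ, ← Real.rpow_mul (by positivity),
          ← Real.rpow_mul (by positivity), one_div_mul_cancel hp0.ne', Real.rpow_one, Real.rpow_one]
        field_simp
      have e3 : (8 * (2 * M * 2 ^ k) * (ε / ρ k)) ^ (p - 1) *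
          ((4 * (p - 1) + 2 * m + 4 + p) * (ε / ρ k)) =
          C₁ * ((2 : ℝ) ^ k) ^ (p - 1) * (ε / ρ k) ^ p := by
        have hs : (ε / ρ k) ^ p = (ε / ρ k) ^ (p - 1) * (ε / ρ k) := by
          rw [← Real.rpow_add_one (by positivity), sub_add_cancel]
        rw [hs, hC₁, show 8 * (2 * M * 2 ^ k) * (ε / ρ k) = 16 * M * 2 ^ k * (ε / ρ k) by ring,
          Real.mul_rpow (by positivity) (by positivity), Real.mul_rpow (by positivity) (by positivity)]
        ring
      rw [e1, e3, e2]
      field_simp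
      norm_num
  obtain ⟨q₀, hq₀⟩ := hunb (2 * M * 2 ^ k₀)
  have hN0 : 0 ≤ gaugeN q₀ := gaugeN_nonneg q₀
  -- The `+ 1` keeps every level at least 1, as `exists_doubling` requires.
  have hiter : ∀ i : ℕ, ∃ q, gaugeN q ≤
      (gaugeN q₀ + 1) * Real.exp (∑ i' ∈ Finset.range i, r (k₀ + i')) ∧
      2 * M * 2 ^ (k₀ + i) ≤ Ψ (u q) := by
    intro i
    induction i with
    | zero => exact ⟨q₀, by simp, by simpa using hq₀⟩
    | succ i ih =>
      have hsum0 : 0 ≤ ∑ i' ∈ Finset.range i, r (k₀ + i') :=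
        Finset.sum_nonneg fun _ _ => (hr0 _).le
      obtain ⟨q, h1, h2⟩ := hstep (k₀ + i) (by omega) _
        (one_le_mul_of_one_le_of_one_le (by linarith) (Real.one_le_exp hsum0)) ih
      refine ⟨q, h1.trans_eq ?_, h2⟩
      rw [Finset.sum_range_succ, Real.exp_add, mul_assoc]
  obtain ⟨B, hB⟩ := (isCompact_gaugeN_le (m := m)
    ((gaugeN q₀ + 1) * Real.exp (∑' i, r (k₀ + i)))).exists_bound_of_continuousOn
      (T.contDiff.continuous.comp hu.contDiff.continuous).continuousOn
  obtain ⟨i, hi⟩ := pow_unbounded_of_one_lt (B / (2 * M)) (one_lt_two (α := ℝ))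
  obtain ⟨q, h1, h2⟩ := hiter i
  have hrs' : Summable fun i => r (k₀ + i) := by
    simpa [add_comm] using (summable_nat_add_iff k₀).2 hrs
  have h3 := hB q (h1.trans (mul_le_mul_of_nonneg_left
    (Real.exp_le_exp.2 (hrs'.sum_le_tsum _ fun _ _ => (hr0 _).le)) (by linarith)))
  have h4 := (le_abs_self _).trans h3
  simp only [Function.comp_apply] at h4
  have h5 : (2 : ℝ) ^ i ≤ 2 ^ (k₀ + i) := pow_le_pow_right₀ one_le_two (by omega)
  have h6 := (div_lt_iff₀ (by positivity : 0 < 2 * M)).1 hi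
  nlinarith

/-! ### Existence: the one-dimensional profile -/

/-- The odd extension of `P : [0, ∞) → ℝ` with `P 0 = 0`. -/
noncomputable def oddExt (P : ℝ → ℝ) (r : ℝ) : ℝ := P (max r 0) - P (max (-r) 0)

lemma oddExt_of_nonneg {P : ℝ → ℝ} (h0 : P 0 = 0) {r : ℝ} (hr : 0 ≤ r) : oddExt P r = P r := by
  rw [oddExt, max_eq_left hr, max_eq_right (neg_nonpos.2 hr), h0, sub_zero]

lemma oddExt_of_nonpos {P : ℝ → ℝ} (h0 : P 0 = 0) {r : ℝ} (hr : r ≤ 0) :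
    oddExt P r = -P (-r) := by
  rw [oddExt, max_eq_right hr, max_eq_left (neg_nonneg.2 hr), h0, zero_sub]

lemma continuous_oddExt {P : ℝ → ℝ} (hP : ContinuousOn P (Ici 0)) : Continuous (oddExt P) :=
  (hP.comp_continuous (by fun_prop) fun r => le_max_right r 0).sub
    (hP.comp_continuous (by fun_prop) fun r => le_max_right (-r) 0)

lemma hasDerivAt_oddExt {P : ℝ → ℝ} {P' r : ℝ} (h0 : P 0 = 0) (hr : r ≠ 0)
    (hP : HasDerivAt P P' |r|) : HasDerivAt (oddExt P) P' r := by
  rcases hr.lt_or_gt with h | h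
  · rw [abs_of_neg h] at hP
    have h1 : HasDerivAt (fun r => -P (-r)) P' r :=
      (HasDerivAt.comp r hP (hasDerivAt_neg r)).fun_neg.congr_deriv (by ring)
    refine h1.congr_of_eventuallyEq ?_
    filter_upwards [gt_mem_nhds h] with s hs using oddExt_of_nonpos h0 (le_of_lt hs)
  · rw [abs_of_pos h] at hP
    refine hP.congr_of_eventuallyEq ?_
    filter_upwards [lt_mem_nhds h] with s hs using oddExt_of_nonneg h0 (le_of_lt hs)

/-- The autonomous equation `z' = γ(|z|)` has a global surjective solution vanishing at `0`,
if `1 / γ` is integrable near `0` but not on `(0, ∞)`. -/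
lemma exists_flow {γ : ℝ → ℝ} (hγ : ContinuousOn γ (Ici 0)) (hpos : ∀ r, 0 < r → 0 < γ r)
    (hint : ∀ b, 0 ≤ b → IntervalIntegrable (fun r => (γ r)⁻¹) volume 0 b)
    (hunb : ∀ B, ∃ b, 0 ≤ b ∧ B ≤ ∫ r in (0 : ℝ)..b, (γ r)⁻¹) :
    ∃ z : ℝ → ℝ, Continuous z ∧ Function.Surjective z ∧ (∀ x, z x = 0 ↔ x = 0) ∧
      ∀ x, x ≠ 0 → HasDerivAt z (γ |z x|) x := by
  let k : ℝ → ℝ := fun s => (γ |s|)⁻¹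
  have hkev : ∀ s, k (-s) = k s := fun s => by simp [k]
  have hkpos : ∀ s, s ≠ 0 → 0 < k s := fun s hs => inv_pos.2 (hpos _ (abs_pos.2 hs))
  have hk0 : ∀ b, 0 ≤ b → IntervalIntegrable k volume 0 b := fun b hb =>
    (hint b hb).congr fun r hr => by
      rw [uIoc_of_le hb] at hr
      simp [k, abs_of_pos hr.1]
  have hk1 : ∀ b, IntervalIntegrable k volume 0 b := fun b => by
    rcases le_total 0 b with hb | hb
    · exact hk0 b hb
    · rw [IntervalIntegrable.iff_comp_neg]
      simpa [hkev] using hk0 (-b) (by linarith)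
  have hk : ∀ a b, IntervalIntegrable k volume a b := fun a b => (hk1 a).symm.trans (hk1 b)
  -- Separation of variables: `G` is the time at which height `s` is reached, and `z` is its
  -- inverse. Starting from rest at 0, this selects the solution that leaves 0 at once.
  let G : ℝ → ℝ := fun s => ∫ r in (0 : ℝ)..s, k r
  have hG0 : G 0 = 0 := intervalIntegral.integral_same
  have hGc : Continuous G := intervalIntegral.continuous_primitive hk 0
  have hGodd : ∀ s, G (-s) = -G s := fun s => by
    have := intervalIntegral.integral_comp_neg (a := 0) (b := s) k
    simp only [hkev, neg_zero] at this
    simp only [G]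
    rw [this, intervalIntegral.integral_symm]
  have hGlt : ∀ a b, a < b → (∀ s ∈ Ioo a b, s ≠ 0) → G a < G b := fun a b hab h => by
    have h1 := intervalIntegral.intervalIntegral_pos_of_pos_on (hk a b)
      (fun s hs => hkpos s (h s hs)) hab
    have h2 := intervalIntegral.integral_add_adjacent_intervals (hk 0 a) (hk a b)
    simp only [G]
    linarith
  have hGm : StrictMono G := StrictMonoOn.Iic_union_Ici (a := 0)
    (fun a _ b hb hab => hGlt a b hab fun s hs => (hs.2.trans_le hb).ne)
    (fun a ha b _ hab => hGlt a b hab fun s hs => ((show (0 : ℝ) ≤ a from ha).trans_lt hs.1).ne')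
  have htop : Tendsto G atTop atTop := hGm.monotone.tendsto_atTop_atTop fun B => by
    obtain ⟨b, hb, hB⟩ := hunb B
    refine ⟨b, hB.trans_eq (intervalIntegral.integral_congr_uIoo fun r hr => ?_)⟩
    rw [uIoo_of_le hb] at hr
    simp [k, abs_of_pos hr.1]
  have hbot : Tendsto G atBot atBot := by
    have : G = fun s => -G (-s) := funext fun s => by rw [hGodd, neg_neg]
    rw [this]
    exact tendsto_neg_atTop_atBot.comp (htop.comp tendsto_neg_atBot_atTop)
  let e := hGm.orderIsoOfSurjective G (hGc.surjective htop hbot)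
  have he : ∀ x, G (e.symm x) = x := fun x => e.apply_symm_apply x
  have hz0 : ∀ x, e.symm x = 0 ↔ x = 0 := fun x => by
    constructor
    · intro h; rw [← he x, h, hG0]
    · rintro rfl; exact hGm.injective ((he 0).trans hG0.symm)
  have hzc : Continuous e.symm := e.symm.toHomeomorph.continuous
  refine ⟨e.symm, hzc, e.symm.surjective, hz0, fun x hx => ?_⟩
  have hzx : e.symm x ≠ 0 := fun h => hx ((hz0 x).1 h)
  have hkc : ContinuousOn k {0}ᶜ := by
    refine ContinuousOn.inv₀ (hγ.comp continuous_abs.continuousOn fun s _ => abs_nonneg s)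
      fun s hs => (hpos _ (abs_pos.2 hs)).ne'
  have hopen : IsOpen ({0}ᶜ : Set ℝ) := isOpen_compl_singleton
  have hGd : HasDerivAt G (k (e.symm x)) (e.symm x) :=
    intervalIntegral.integral_hasDerivAt_right (hk _ _)
      (hkc.stronglyMeasurableAtFilter hopen _ hzx) (hkc.continuousAt (hopen.mem_nhds hzx))
  have := HasDerivAt.of_local_left_inverse hzc.continuousAt hGd (hkpos _ hzx).ne'
    (Eventually.of_forall he)
  simpa [k] using this

lemma CondF.hasDerivAt_primF {f : ℝ → ℝ} (hF : CondF f) {t : ℝ} (ht : 0 < t) :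
    HasDerivAt (primF f) (f t) t :=
  have hc : ContinuousOn f (Ioi 0) := hF.continuousOn.mono Ioi_subset_Ici_self
  intervalIntegral.integral_hasDerivAt_right (hF.intervalIntegrable le_rfl ht.le)
    (hc.stronglyMeasurableAtFilter isOpen_Ioi t ht) (hc.continuousAt (Ioi_mem_nhds ht))

lemma CondF.mul_le_primF_sub {f : ℝ → ℝ} (hF : CondF f) {r : ℝ} (hr : 0 ≤ r) :
    r * f 1 ≤ primF f (1 + r) - primF f 1 := by
  have h1 : primF f (1 + r) - primF f 1 = ∫ s in (1 : ℝ)..(1 + r), f s :=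
    intervalIntegral.integral_interval_sub_left
      (hF.intervalIntegrable le_rfl (by linarith)) (hF.intervalIntegrable le_rfl zero_le_one)
  have h2 := intervalIntegral.integral_mono_on (by linarith : (1 : ℝ) ≤ 1 + r)
    (intervalIntegrable_const (μ := volume) (c := f 1))
    (hF.intervalIntegrable zero_le_one (by linarith)) fun s hs =>
      hF.monotoneOn (zero_le_one' ℝ) (zero_le_one.trans hs.1) hs.1
  rw [h1]
  simpa using h2

/-- If the Keller-Osserman condition fails, `(|w'|^(p-2) w')' = f(w)` has a positive entire
solution on the line. -/
lemma exists_profile {p : ℝ} (hp : 1 < p) {f : ℝ → ℝ} (hF : CondF f)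
    (hKO : ¬ KellerOsserman (phiP p) f) :
    ∃ w D V : ℝ → ℝ, (∀ x, HasDerivAt w (D x) x) ∧ Continuous D ∧
      (∀ x, HasDerivAt V (f (w x)) x) ∧ (∀ x, |D x|⁻¹ * phiP p |D x| * D x = V x) ∧
      (∀ x, 1 ≤ w x) ∧ ∃ x y, w x ≠ w y := by
  have hp0 : 0 < p := by linarith
  have hp1 : 0 < p - 1 := by linarith
  set c := p / (p - 1) with hc
  have hc0 : 0 < c := by positivity
  have hf1 := hF.pos 1 one_pos
  -- By the first integral, `|w'|^p = Φ(w - 1)`. Hence `γ` is the speed `|w'|` and `P = γ^(p-1)` the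
  -- size of the flux, both as functions of the height above 1.
  let Φ : ℝ → ℝ := fun r => c * (primF f (1 + r) - primF f 1)
  have hΦd : ∀ r, 0 ≤ r → HasDerivAt Φ (c * f (1 + r)) r := fun r hr =>
    (((hF.hasDerivAt_primF (by linarith : 0 < 1 + r)).comp_const_add 1 r).sub_const _).const_mul c
  have hΦc : ContinuousOn Φ (Ici 0) := fun r hr => (hΦd r hr).continuousAt.continuousWithinAt
  have hΦ0 : Φ 0 = 0 := by simp [Φ]
  have hΦle : ∀ r, 0 ≤ r → c * f 1 * r ≤ Φ r := fun r hr =>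
    (mul_le_mul_of_nonneg_left (hF.mul_le_primF_sub hr) hc0.le).trans_eq' (by ring)
  have hΦpos : ∀ r, 0 < r → 0 < Φ r := fun r hr => (by positivity : 0 < c * f 1 * r).trans_le
    (hΦle r hr.le)
  let γ : ℝ → ℝ := fun r => Φ r ^ (1 / p)
  let P : ℝ → ℝ := fun r => Φ r ^ ((p - 1) / p)
  have hγc : ContinuousOn γ (Ici 0) := hΦc.rpow_const fun r _ => Or.inr (by positivity)
  have hPc : ContinuousOn P (Ici 0) := hΦc.rpow_const fun r _ => Or.inr (by positivity)
  have hγ0 : γ 0 = 0 := by simp only [γ, hΦ0]; exact Real.zero_rpow (by positivity)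
  have hP0 : P 0 = 0 := by simp only [P, hΦ0]; exact Real.zero_rpow (by positivity)
  have hγpos : ∀ r, 0 < r → 0 < γ r := fun r hr => Real.rpow_pos_of_pos (hΦpos r hr) _
  have hPγ : ∀ r, 0 ≤ r → P r = |γ r|⁻¹ * phiP p |γ r| * γ r := fun r hr => by
    rcases hr.eq_or_lt with rfl | hr
    · rw [hP0, hγ0]; simp
    · have h := hγpos r hr
      rw [abs_of_pos h, phiP]
      simp only [γ, P]
      rw [← Real.rpow_mul (hΦpos r hr).le, show 1 / p * (p - 1) = (p - 1) / p by ring]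
      have : Φ r ^ (1 / p) ≠ 0 := h.ne'
      field_simp
  have hint : ∀ b, 0 ≤ b → IntervalIntegrable (fun r => (γ r)⁻¹) volume 0 b := fun b hb => by
    -- The speed vanishes at 0, but `Φ r ≥ c f(1) r` bounds `1 / γ` by a multiple of `r^(-1/p)`,
    -- integrable as `p > 1`.
    have hr : (-1 : ℝ) < -(1 / p) := by
      rw [neg_lt_neg_iff, div_lt_one hp0]; exact hp
    refine ((intervalIntegral.intervalIntegrable_rpow' (a := 0) (b := b) hr).const_mul
      ((c * f 1) ^ (-(1 / p)))).mono_fun' ?_ ?_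
    · rw [uIoc_of_le hb]
      refine ContinuousOn.aestronglyMeasurable ?_ measurableSet_Ioc
      exact (hγc.mono fun r hr => hr.1.le).inv₀ fun r hr => (hγpos r hr.1).ne'
    · rw [uIoc_of_le hb]
      refine (ae_restrict_iff' measurableSet_Ioc).2 (Eventually.of_forall fun r hr => ?_)
      have h := hγpos r hr.1
      have hr0 := hr.1
      simp only
      rw [Real.norm_of_nonneg (inv_pos.2 h).le, ← Real.mul_rpow (by positivity) hr.1.le]
      simp only [γ]
      rw [← Real.rpow_neg (hΦpos r hr.1).le]
      exact Real.rpow_le_rpow_of_nonpos (by positivity) (hΦle r hr.1.le)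
        (neg_nonpos.2 (by positivity))
  have hunb : ∀ B, ∃ b, 0 ≤ b ∧ B ≤ ∫ r in (0 : ℝ)..b, (γ r)⁻¹ := by
    by_contra! hcon
    obtain ⟨B, hB⟩ := hcon
    have hFpos : ∀ t, 0 < t → 0 < c * primF f t := fun t ht => mul_pos hc0 (hF.primF_pos ht)
    -- This is `1 / K⁻¹(F(t))`. Dropping `F(1)` gives `κ t ≤ 1 / γ(t - 1)`, so a bounded travel time
    -- would make it integrable at infinity.
    let κ : ℝ → ℝ := fun t => (c * primF f t) ^ (-(1 / p))
    have hκ : ContinuousOn κ (Ioi 0) := ContinuousOn.rpow_const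
      (continuousOn_const.mul fun t ht => (hF.hasDerivAt_primF ht).continuousAt.continuousWithinAt)
      fun t ht => Or.inl (hFpos t ht).ne'
    have hκI : ∀ i, IntegrableOn κ (Icc 1 i) := fun i =>
      (hκ.mono fun t ht => one_pos.trans_le ht.1).integrableOn_Icc
    have hκint : IntegrableOn κ (Ioi 1) := by
      refine integrableOn_Ioi_of_intervalIntegral_norm_bounded (l := atTop) (b := id) B 1
        (fun i => (hκI i).mono_set Ioc_subset_Icc_self) tendsto_id ?_
      filter_upwards [eventually_ge_atTop 1] with i hi
      have hi0 : 0 ≤ i - 1 := by linarith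
      have hshift := (hint (i - 1) hi0).comp_sub_right 1
      rw [zero_add, sub_add_cancel] at hshift
      have hmono := intervalIntegral.integral_mono_on_of_le_Ioo (f := fun t => ‖κ t‖) hi
        ((intervalIntegrable_iff_integrableOn_Icc_of_le hi).2 (hκI i).norm) hshift fun t ht => by
          have h0 : 0 < t - 1 := by linarith [ht.1]
          have ht0 : 0 < t := one_pos.trans ht.1
          rw [Real.norm_of_nonneg (Real.rpow_nonneg (hFpos t ht0).le _)]
          simp only [γ]
          rw [← Real.rpow_neg (hΦpos _ h0).le]
          refine Real.rpow_le_rpow_of_nonpos (hΦpos _ h0) ?_ (neg_nonpos.2 (by positivity))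
          have := hF.primF_pos one_pos
          simp only [Φ, add_sub_cancel]
          exact mul_le_mul_of_nonneg_left (by linarith) hc0.le
      rw [intervalIntegral.integral_comp_sub_right (fun r => (γ r)⁻¹) 1, sub_self] at hmono
      exact hmono.trans (hB _ hi0).le
    refine hKO ⟨Ioi 1, Ioi_mem_atTop 1, hκint.congr_fun (fun t ht => ?_) measurableSet_Ioi⟩
    have ht0 : 0 < t := one_pos.trans ht
    simp only [κ]
    rw [Kinv_phiP hp (hF.primF_pos ht0).le, Real.rpow_neg (hFpos t ht0).le, one_div (_ ^ (1 / p))]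
  obtain ⟨z, hzc, hzs, hz0, hzd⟩ := exists_flow hγc hγpos hint hunb
  have hzne : ∀ x, x ≠ 0 → z x ≠ 0 := fun x hx h => hx ((hz0 x).1 h)
  -- `w` is even and decreases to 1 before increasing, so its derivative and flux are odd in `z`;
  -- hence the odd extensions of `γ` and `P`.
  let w : ℝ → ℝ := fun x => 1 + |z x|
  have hw1 : ∀ x, 1 ≤ w x := fun x => le_add_of_nonneg_right (abs_nonneg _)
  have hwc : Continuous w := continuous_const.add hzc.abs
  have hfw : Continuous fun x => f (w x) :=
    hF.continuousOn.comp_continuous hwc fun x => zero_le_one.trans (hw1 x)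
  have hDc : Continuous fun x => oddExt γ (z x) := (continuous_oddExt hγc).comp hzc
  have hVc : Continuous fun x => oddExt P (z x) := (continuous_oddExt hPc).comp hzc
  refine ⟨w, fun x => oddExt γ (z x), fun x => oddExt P (z x), ?_, hDc, ?_, fun x => ?_, hw1, ?_⟩
  · refine hasDerivAt_of_hasDerivAt_of_ne' (x := 0) (fun x hx => ?_) hwc.continuousAt
      hDc.continuousAt
    have hne := hzne x hx
    have h1 : HasDerivAt w _ x := ((hasDerivAt_abs hne).comp x (hzd x hx)).const_add 1
    refine h1.congr_deriv ?_
    rcases hne.lt_or_gt with h | h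
    · simp [oddExt_of_nonpos hγ0 h.le, abs_of_neg h, h]
    · simp [oddExt_of_nonneg hγ0 h.le, abs_of_pos h, h]
  · refine hasDerivAt_of_hasDerivAt_of_ne' (x := 0) (fun x hx => ?_) hVc.continuousAt
      hfw.continuousAt
    have hne := hzne x hx
    have hpos := abs_pos.2 hne
    have hP : HasDerivAt P _ |z x| := (hΦd _ hpos.le).rpow_const (Or.inl (hΦpos _ hpos).ne')
    have h1 := (hasDerivAt_oddExt hP0 hne hP).comp x (hzd x hx)
    refine h1.congr_deriv ?_
    have hX := hΦpos _ hpos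
    have e1 : (p - 1) / p - 1 = -(1 / p) := by field_simp; ring
    simp only [γ, w]
    rw [e1, Real.rpow_neg hX.le, mul_assoc, inv_mul_cancel₀ (Real.rpow_pos_of_pos hX _).ne', hc]
    field_simp
  · rcases le_total 0 (z x) with h | h
    · simp only [oddExt_of_nonneg hγ0 h, oddExt_of_nonneg hP0 h, hPγ _ h]
    · simp only [oddExt_of_nonpos hγ0 h, oddExt_of_nonpos hP0 h, hPγ _ (neg_nonneg.2 h), abs_neg]
      ring
  · obtain ⟨x, hx⟩ := hzs 0
    obtain ⟨y, hy⟩ := hzs 1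
    exact ⟨x, y, by simp [w, hx, hy]⟩

/-! ### Lifting the profile to the Heisenberg group -/

/-- A one-dimensional profile, read as a function of the coordinate `x_j`, solves the weak
inequality on the Heisenberg group. -/
lemma isWeakSolution_profile {m : ℕ} (j : Fin m) {p : ℝ} {f h g w D V : ℝ → ℝ} (hF : CondF f)
    (hH : CondH h) (hg : ContinuousOn g (Ici 0)) (hg0 : ∀ t, 0 ≤ t → 0 ≤ g t)
    (hw : ∀ x, HasDerivAt w (D x) x) (hD : Continuous D) (hV : ∀ x, HasDerivAt V (f (w x)) x)
    (hDV : ∀ x, |D x|⁻¹ * phiP p |D x| * D x = V x) (hw1 : ∀ x, 1 ≤ w x) :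
    IsWeakSolution (phiP p) f h g fun q : Heis m => w (q.1 j) := by
  let l : Heis m →L[ℝ] ℝ := ContinuousLinearMap.proj (R := ℝ) (φ := fun _ => ℝ) j ∘L
    ContinuousLinearMap.fst ℝ (Fin m → ℝ) ((Fin m → ℝ) × ℝ)
  have hl : ∀ q : Heis m, HasFDerivAt (fun q : Heis m => q.1 j) l q := fun q => l.hasFDerivAt
  have hcd : ∀ {W W' : ℝ → ℝ}, (∀ x, HasDerivAt W (W' x) x) → Continuous W' → ContDiff ℝ 1 W :=
    fun hW hc => contDiff_one_iff_deriv.2 ⟨fun x => (hW x).differentiableAt, by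
      rwa [funext fun x => (hW x).deriv]⟩
  have hwc : ContDiff ℝ 1 w := hcd hw hD
  have hfw : Continuous fun x => f (w x) :=
    hF.continuousOn.comp_continuous hwc.continuous fun x => zero_le_one.trans (hw1 x)
  have hVc : ContDiff ℝ 1 V := hcd hV hfw
  have hu : ContDiff ℝ 1 fun q : Heis m => w (q.1 j) := hwc.comp l.contDiff
  have hgrad : ∀ q : Heis m, gradH (fun q : Heis m => w (q.1 j)) q =
      EuclideanSpace.single (Sum.inl j) (D (q.1 j)) := fun q => by
    have hd : HasFDerivAt (fun q : Heis m => w (q.1 j)) (D (q.1 j) • l) q :=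
      (hw _).comp_hasFDerivAt q (hl q)
    rw [gradH_eq_horiz, hd.fderiv]
    ext i
    rcases i with i | i
    · rcases eq_or_ne i j with rfl | hij
      · simp [horiz, l]
      · simp [horiz, l, hij, hij.symm]
    · simp [horiz, l]
  have hnorm : ∀ q : Heis m, ‖gradH (fun q : Heis m => w (q.1 j)) q‖ = |D (q.1 j)| := fun q => by
    rw [hgrad, PiLp.norm_single, Real.norm_eq_abs]
  have hfu : Continuous fun q : Heis m => f (w (q.1 j)) := hfw.comp l.continuous
  have hrhs : Continuous fun q : Heis m => f (w (q.1 j)) - h (w (q.1 j)) * g |D (q.1 j)| := by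
    refine hfu.sub (Continuous.mul ?_ ?_)
    -- The profile stays above 1, away from the possible singularity of `h`.
    · exact hH.continuousOn.comp_continuous hu.continuous fun q => one_pos.trans_le (hw1 _)
    · exact hg.comp_continuous (hD.comp l.continuous).abs fun q => mem_Ici.2 (abs_nonneg _)
  refine ⟨hu, ?_, fun ζ hζ hc h0 => ?_⟩
  · simp only [hnorm]
    exact hrhs.locallyIntegrable
  · have hζ1 : ContDiff ℝ 1 ζ := hζ.of_le (by simp)
    have hVq : ContDiff ℝ 1 fun q : Heis m => V (q.1 j) := hVc.comp l.contDiff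
    have hW : ContDiff ℝ 1 fun q : Heis m => V (q.1 j) * (2 * q.2.1 j) := hVq.mul (by fun_prop)
    have hflux : ∀ q : Heis m, ‖gradH (fun q : Heis m => w (q.1 j)) q‖⁻¹ *
        phiP p ‖gradH (fun q : Heis m => w (q.1 j)) q‖ *
        inner ℝ (gradH (fun q : Heis m => w (q.1 j)) q) (gradH ζ q) =
        V (q.1 j) * fderiv ℝ ζ q (Pi.single j 1, 0, 0) +
        V (q.1 j) * (2 * q.2.1 j) * fderiv ℝ ζ q (0, 0, 1) := fun q => by
      have hX : fderiv ℝ ζ q (Pi.single j 1, 0, 2 * q.2.1 j) =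
          fderiv ℝ ζ q (Pi.single j 1, 0, 0) + 2 * q.2.1 j * fderiv ℝ ζ q (0, 0, 1) := by
        rw [← smul_eq_mul (2 * q.2.1 j) (fderiv ℝ ζ q _), ← map_smul, ← map_add]; simp
      rw [hnorm, hgrad, EuclideanSpace.inner_single_left, ← hDV]
      simp only [gradH, fieldX, Sum.elim_inl, conj_trivial, hX]
      ring
    have hVd : ∀ q : Heis m, fderiv ℝ (fun q : Heis m => V (q.1 j)) q (Pi.single j 1, 0, 0) =
        f (w (q.1 j)) := fun q => by
      have hd : HasFDerivAt (fun q : Heis m => V (q.1 j)) (f (w (q.1 j)) • l) q :=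
        (hV _).comp_hasFDerivAt q (hl q)
      rw [hd.fderiv]
      simp [l]
    -- The `t`-component `2 y_j V(x_j)` of the flux does not depend on `t`, so the divergence is
    -- just `V'(x_j) = f(w(x_j))`.
    have hWd : ∀ q : Heis m,
        fderiv ℝ (fun q : Heis m => V (q.1 j) * (2 * q.2.1 j)) q (0, 0, 1) = 0 := fun q => by
      have hd : HasFDerivAt (fun q : Heis m => V (q.1 j)) (f (w (q.1 j)) • l) q :=
        (hV _).comp_hasFDerivAt q (hl q)
      have hy : HasFDerivAt (fun q : Heis m => 2 * q.2.1 j) ((2 : ℝ) •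
          (ContinuousLinearMap.proj (R := ℝ) (φ := fun _ => ℝ) j ∘L
            ContinuousLinearMap.fst ℝ (Fin m → ℝ) ℝ ∘L
              ContinuousLinearMap.snd ℝ (Fin m → ℝ) ((Fin m → ℝ) × ℝ))) q :=
        (ContinuousLinearMap.proj (R := ℝ) (φ := fun _ => ℝ) j ∘L
          ContinuousLinearMap.fst ℝ (Fin m → ℝ) ℝ ∘L
            ContinuousLinearMap.snd ℝ (Fin m → ℝ) ((Fin m → ℝ) × ℝ)).hasFDerivAt.const_mul 2
      rw [(hd.fun_mul hy).fderiv]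
      simp [l]
    simp only [hflux]
    rw [integral_add (integrable_mul_fderiv hVq.continuous hζ1 hc _)
      (integrable_mul_fderiv hW.continuous hζ1 hc _), integral_mul_fderiv_eq_neg hVq hζ1 hc,
      integral_mul_fderiv_eq_neg hW hζ1 hc]
    simp only [hVd, hWd, hnorm, zero_mul, integral_zero, neg_zero, add_zero, neg_neg]
    refine integral_mono (integrable_mul_of_hasCompactSupport hrhs hζ.continuous hc)
      (integrable_mul_of_hasCompactSupport hfu hζ.continuous hc) fun q => ?_
    refine mul_le_mul_of_nonneg_right (sub_le_self _ ?_) (h0 q)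
    exact mul_nonneg (hH.nonneg _ (one_pos.trans_le (hw1 _))) (hg0 _ (abs_nonneg _))

end HeisenbergKO

theorem mainTheorem5 (m : ℕ) (hm : 1 ≤ m) (p : ℝ) (hp : 1 < p) (f h g : ℝ → ℝ)
    (hF : CondF f) (hH : CondH h)
    (hg : ContinuousOn g (Ici 0)) (hg_nonneg : ∀ t, 0 ≤ t → 0 ≤ g t)
    (hG : CondG (phiP p) 0 g) (hPhi2 : CondPhi2 (phiP p) 0) (hPhi3 : CondPhi3 (phiP p))
    (hL1 : IntegrableOn h (Ioi 0) volume) :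
    (∃ u : Heis m → ℝ, IsWeakSolution (phiP p) f h g u ∧ (∀ q, 0 ≤ u q) ∧
      ¬ ∃ c : ℝ, ∀ q, u q = c) ↔
    ¬ KellerOsserman (phiP p) f := by
  constructor
  · rintro ⟨u, hu, hu0, hne⟩ hKO
    exact hne ⟨0, eq_zero_of_kellerOsserman hp hF hH hL1 hG hKO hu hu0⟩
  · intro hKO
    obtain ⟨w, D, V, hw, hD, hV, hDV, hw1, a, b, hab⟩ := exists_profile hp hF hKO
    refine ⟨_, isWeakSolution_profile ⟨0, hm⟩ hF hH hg hg_nonneg hw hD hV hDV hw1,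
      fun q => zero_le_one.trans (hw1 _), ?_⟩
    rintro ⟨c, hc⟩
    exact hab ((hc (fun _ => a, 0, 0)).trans (hc (fun _ => b, 0, 0)).symm)
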